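/- **Types and terms.** Simple types are generated from a base type $N$ by $\sigma\to\tau$, with $\mathrm{lev}(N)=0$ and $\mathrm{lev}(\sigma\to\tau)=\max(1+\mathrm{lev}(\sigma),\mathrm{lev}(\tau))$. A sequent $\sigma_1,\dots,\sigma_k\Rightarrow\tau$ denotes the type $\sigma_1\to\cdots\to\sigma_k\to\tau$. Consider the typing rules - $\mathsf{ex}$: from $\vec\rho,\sigma,\rho,\vec\sigma\Rightarrow\tau$ infer $\vec\rho,\rho,\sigma,\vec\sigma\Rightarrow\tau$; - $\mathsf{wk}$: from $\vec\sigma\Rightarrow\tau$ infer $\vec\sigma,\sigma\Rightarrow\tau$; - $\mathsf{cntr}$: from $\vec\sigma,\sigma,\sigma\Rightarrow\tau$ infer $\vec\sigma,\sigma\Rightarrow\tau$; - $\mathsf{cut}$: from $\vec\sigma\Rightarrow\sigma$ and $\vec\sigma,\sigma\Rightarrow\tau$ infer $\vec\sigma\Rightarrow\tau$; - $\mathsf{L}$: from $\vec\sigma\Rightarrow\rho$ and $\vec\sigma,\sigma\Rightarrow\tau$ infer $\vec\sigma,\rho\to\sigma\Rightarrow\tau$; - $\mathsf{R}$: from $\vec\sigma,\sigma\Rightarrow\tau$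 infer $\vec\sigma\Rightarrow\sigma\to\tau$; - the axioms $\mathsf{id}:\sigma\Rightarrow\sigma$, $\;0:\ \Rightarrow N$, $\;\mathsf{s}:N\Rightarrow N$; - $\mathsf{cond}$: from $\vec\sigma\Rightarrow\tau$ and $\vec\sigma,N\Rightarrow\tau$ infer $\vec\sigma,N\Rightarrow\tau$; - $\mathsf{rec}_\tau$: from $\vec\sigma\Rightarrow\tau$ and $\vec\sigma,N,\tau\Rightarrow\tau$ infer $\vec\sigma,N\Rightarrow\tau$. Each rule instance is a constant whose type takes the types of its premisses to that of its conclusion. Terms are built from typed variables and constants by typed application. A term *of $T_{m}$* is one whose constants are rule instances other than $\mathsf{cond}$, where $\mathsf{rec}_\tau$ is admitted only for $\mathrm{lev}(\tau)\le m$. **Circular fragment.** A coderivation is a possibly infinite tree of instances of the above rules except $\mathsf{rec}$, in which the children of each node conclude exactly the premisses of that node. It is *regular* if it has finitely many distinct subtrees. *Immediate ancestry* relates each type occurrence in the antecedent of a conclusion to the corresponding occurrences in the antecedents of the premisses: context types correspond by position (permuted for $\mathsf{ex}$), the contracted $\sigma$ of $\mathsf{cntr}$ corresponds to both copies, the principal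 $N$ of $\mathsf{cond}$ to the $N$ of the right premiss, and there are no other relations. A coderivation is *progressing* if along every infinite branch some infinite path of immediate ancestry, possibly starting above the root, is infinitely often at the principal $N$ of a $\mathsf{cond}$ step. A *coderivation of $C_n$* is a regular progressing coderivation in which all types occurring have level $\le n$. **Theory.** $C_n,\mathsf{rec}_{n+1}$ is the classical many-sorted first-order theory, with equality at every type, whose constants are all instances of the rules other than $\mathsf{rec}$ (of any type), all coderivations of $C_n$ (a coderivation of $\vec\sigma\Rightarrow\tau$ being a constant of type $\vec\sigma\to\tau$), and all recursors $\mathsf{rec}_\tau$ with $\mathrm{lev}(\tau)\le n+1$. A coderivation with last step $r$ and immediate sub-coderivations $D_1,\dots,D_j$ is identified with $r\,D_1\cdots D_j$. The axioms and rules are: reflexivity and Leibniz's law for equality; the extensionality rule (if $\vdash s\,x=t\,x$ with $x$ not in $s,t$, then $\vdash s=t$); all instances of $$\begin{array}{ll} \mathsf{id}\,x=x & \mathsf{ex}\,t\,\vec x\,x\,y\,\vec y=t\,\vec x\,y\,x\,\vec y\\ \mathsf{wk}\,t\,\vec x\,x=t\,\vec x & \mathsf{cntr}\,t\,\vec x\,x=t\,\vec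 x\,x\,x\\ \mathsf{cut}\,s\,t\,\vec x=t\,\vec x\,(s\,\vec x) & \mathsf{L}\,s\,t\,\vec x\,y=t\,\vec x\,(y\,(s\,\vec x))\\ \mathsf{R}\,t\,\vec x\,x=t\,\vec x\,x & \\ \mathsf{cond}\,s\,t\,\vec x\,0=s\,\vec x & \mathsf{cond}\,s\,t\,\vec x\,(\mathsf{s}\,y)=t\,\vec x\,y\\ \mathsf{rec}\,s\,t\,\vec x\,0=s\,\vec x & \mathsf{rec}\,s\,t\,\vec x\,(\mathsf{s}\,y)=t\,\vec x\,y\,(\mathsf{rec}\,s\,t\,\vec x\,y); \end{array}$$ $\neg\,\mathsf{s}\,x=0$; $\ \mathsf{s}\,x=\mathsf{s}\,y\supset x=y$; and the induction rule (if $\vdash\varphi(0)$ and $\vdash\varphi(x)\supset\varphi(\mathsf{s}\,x)$ with $\varphi$ quantifier-free, then $\vdash\varphi(t)$). **Theorem.** Let $n\ge 0$ and let $t$ be a closed term of $T_{n+1}$ of type $\sigma$ with $\mathrm{lev}(\sigma)\le n+1$. Write $\sigma=\sigma_1\to\cdots\to\sigma_k\to\tau$ in any way with $k\ge 0$ and $\mathrm{lev}(\tau)\le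 n$ (for example with $\tau=N$, which is always possible). Then there is a coderivation $t'$ of $C_n$ with conclusion $\sigma_1,\dots,\sigma_k\Rightarrow\tau$, hence of type $\sigma$ as a term, such that $$C_n,\mathsf{rec}_{n+1}\vdash t=t'.$$ -/

import Mathlib

namespace CircularT

/-! ### Simple types and sequents -/

/-- Simple types over the base type `N`. -/
inductive Ty : Type
  | N : Ty
  | arr : Ty → Ty → Ty

infixr:60 " ⇾ " => Ty.arr

/-- The level of a type. -/
def Ty.lev : Ty → ℕ
  | .N => 0
  | .arr σ τ => max (1 + σ.lev) τ.lev

/-- `arrows [σ₁, …, σₖ] τ` is the type `σ₁ → ⋯ → σₖ → τ`. -/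
def arrows : List Ty → Ty → Ty
  | [], τ => τ
  | σ :: Γ, τ => σ ⇾ arrows Γ τ

/-- The list `σ₁, …, σₖ` such that the given type is `σ₁ → ⋯ → σₖ → N`. -/
def Ty.args : Ty → List Ty
  | .N => []
  | .arr σ τ => σ :: τ.args

/-- Every type is `σ₁ → ⋯ → σₖ → N` for its list `σ₁, …, σₖ` of arguments. -/
theorem arrows_args (σ : Ty) : arrows σ.args .N = σ := by
  induction σ with
  | N => rfl
  | arr σ τ _ ih => simp [Ty.args, arrows, ih]

/-- A sequent `σ₁, …, σₖ ⇒ τ`. -/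
structure Sequent : Type where
  ant : List Ty
  suc : Ty

/-- The type `σ₁ → ⋯ → σₖ → τ` denoted by the sequent `σ₁, …, σₖ ⇒ τ`. -/
def Sequent.ty (S : Sequent) : Ty := arrows S.ant S.suc

/-! ### Typing rules -/

/-- The inference steps (rule instances) of the recursor-free fragment of `T`, together with
the conditional. -/
inductive Step : Type
  | ex (Γ : List Ty) (ρ σ : Ty) (Δ : List Ty) (τ : Ty)
  | wk (Γ : List Ty) (σ τ : Ty)
  | cntr (Γ : List Ty) (σ τ : Ty)
  | cut (Γ : List Ty) (σ τ : Ty)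
  | id (σ : Ty)
  | L (Γ : List Ty) (ρ σ τ : Ty)
  | R (Γ : List Ty) (σ τ : Ty)
  | zero
  | succ
  | cond (Γ : List Ty) (τ : Ty)

/-- The conclusion of a step. -/
def Step.concl : Step → Sequent
  | .ex Γ ρ σ Δ τ => ⟨Γ ++ ρ :: σ :: Δ, τ⟩
  | .wk Γ σ τ => ⟨Γ ++ [σ], τ⟩
  | .cntr Γ σ τ => ⟨Γ ++ [σ], τ⟩
  | .cut Γ _ τ => ⟨Γ, τ⟩
  | .id σ => ⟨[σ], σ⟩
  | .L Γ ρ σ τ => ⟨Γ ++ [ρ ⇾ σ], τ⟩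
  | .R Γ σ τ => ⟨Γ, σ ⇾ τ⟩
  | .zero => ⟨[], .N⟩
  | .succ => ⟨[.N], .N⟩
  | .cond Γ τ => ⟨Γ ++ [.N], τ⟩

/-- The premisses of a step, from left to right. -/
def Step.premises : Step → List Sequent
  | .ex Γ ρ σ Δ τ => [⟨Γ ++ σ :: ρ :: Δ, τ⟩]
  | .wk Γ _ τ => [⟨Γ, τ⟩]
  | .cntr Γ σ τ => [⟨Γ ++ [σ, σ], τ⟩]
  | .cut Γ σ τ => [⟨Γ, σ⟩, ⟨Γ ++ [σ], τ⟩]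
  | .id _ => []
  | .L Γ ρ σ τ => [⟨Γ, ρ⟩, ⟨Γ ++ [σ], τ⟩]
  | .R Γ σ τ => [⟨Γ ++ [σ], τ⟩]
  | .zero => []
  | .succ => []
  | .cond Γ τ => [⟨Γ, τ⟩, ⟨Γ ++ [.N], τ⟩]

/-- A step is a constant whose type takes the types of the premisses to that of the conclusion. -/
def Step.ty (r : Step) : Ty := arrows (r.premises.map Sequent.ty) r.concl.ty

/-- Immediate ancestry: `r.Ancestor i p q` says that the type at position `q` in the antecedent of
the `i`th premiss of `r` is an immediate ancestor of the type at position `p` in the antecedent of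
the conclusion of `r`. Positions and premisses are counted from `0`. -/
def Step.Ancestor : Step → ℕ → ℕ → ℕ → Prop
  | .ex Γ _ _ Δ _, i, p, q =>
      i = 0 ∧ p < Γ.length + 2 + Δ.length ∧ q = Equiv.swap Γ.length (Γ.length + 1) p
  | .wk Γ _ _, i, p, q => i = 0 ∧ p < Γ.length ∧ q = p
  | .cntr Γ _ _, i, p, q =>
      i = 0 ∧ ((p < Γ.length ∧ q = p) ∨
        (p = Γ.length ∧ (q = Γ.length ∨ q = Γ.length + 1)))
  | .cut Γ _ _, i, p, q => (i = 0 ∨ i = 1) ∧ p < Γ.length ∧ q = p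
  | .id _, _, _, _ => False
  | .L Γ _ _ _, i, p, q => (i = 0 ∨ i = 1) ∧ p < Γ.length ∧ q = p
  | .R Γ _ _, i, p, q => i = 0 ∧ p < Γ.length ∧ q = p
  | .zero, _, _, _ => False
  | .succ, _, _, _ => False
  | .cond Γ _, i, p, q =>
      (i = 0 ∧ p < Γ.length ∧ q = p) ∨ (i = 1 ∧ p < Γ.length + 1 ∧ q = p)

/-- The antecedent position `p` is the principal `N` of a `cond` step. -/
def Step.CondPrincipal : Step → ℕ → Prop
  | .cond Γ _, p => p = Γ.length
  | _, _ => False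

/-! ### Coderivations -/

/-- A possibly infinite tree labelled by steps: the label at each address, if there is a node. The
address `[i₀, i₁, …]` leads from the root to its `i₀`th child, then to the `i₁`th child of
that, and so on. -/
def CoTree : Type := List ℕ → Option Step

/-- The subtree at an address. -/
def CoTree.subtree (T : CoTree) (a : List ℕ) : CoTree := fun b => T (a ++ b)

/-- The tree with root label `r` and the given immediate subtrees. -/
def CoTree.node (r : Step) (Ts : List CoTree) : CoTree
  | [] => some r
  | i :: a => Ts[i]?.bind fun T => T a

/-- `T` is a coderivation of the sequent `S`: the root concludes `S`, and the children of each node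
correspond to the premisses of its step and conclude them. -/
structure CoTree.IsCoderivation (T : CoTree) (S : Sequent) : Prop where
  root : (T []).map Step.concl = some S
  correct : ∀ (a : List ℕ) (i : ℕ),
    (T (a ++ [i])).map Step.concl = (T a).bind fun r => r.premises[i]?

/-- Every type occurring in the tree has level at most `n`. -/
def CoTree.LevelLE (T : CoTree) (n : ℕ) : Prop :=
  ∀ a r, T a = some r → (∀ σ ∈ r.concl.ant, σ.lev ≤ n) ∧ r.concl.suc.lev ≤ n

/-- There are only finitely many distinct subtrees. -/
def CoTree.Regular (T : CoTree) : Prop :=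
  {U : CoTree | ∃ a, (T a).isSome ∧ U = T.subtree a}.Finite

/-- The address reached after `k` steps along the branch `β`. -/
def branchAddr (β : ℕ → ℕ) (k : ℕ) : List ℕ := (List.range k).map β

/-- `β` is an infinite branch. -/
def CoTree.IsBranch (T : CoTree) (β : ℕ → ℕ) : Prop := ∀ k, (T (branchAddr β k)).isSome

/-- `p k, p (k + 1), …` are the antecedent positions of an infinite thread along the branch `β`,
starting at the `k`th node of the branch. -/
def CoTree.IsThread (T : CoTree) (β : ℕ → ℕ) (k : ℕ) (p : ℕ → ℕ) : Prop :=
  ∀ m, k ≤ m → ∃ r, T (branchAddr β m) = some r ∧ r.Ancestor (β m) (p m) (p (m + 1))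

/-- Every infinite branch has a thread that is infinitely often principal for a `cond` step. (Such
a thread consists of occurrences of `N`, since ancestry preserves types.) -/
def CoTree.Progressing (T : CoTree) : Prop :=
  ∀ β, T.IsBranch β → ∃ k p, T.IsThread β k p ∧
    ∀ l, ∃ m, l ≤ m ∧ k ≤ m ∧ ∃ r, T (branchAddr β m) = some r ∧ r.CondPrincipal (p m)

/-- The coderivations of `C_n` with conclusion `S`: regular progressing coderivations in which all
types have level at most `n`. -/
structure Coder (n : ℕ) (S : Sequent) : Type where
  tree : CoTree
  isCoderivation : tree.IsCoderivation S
  levelLE : tree.LevelLE n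
  regular : tree.Regular
  progressing : tree.Progressing

/-! ### The language of `C_n` with recursors of level at most `n + 1` -/

/-- The constants: all individual steps (of arbitrary type), the recursors `rec_τ` with
`lev τ ≤ n + 1`, and all coderivations of `C_n`. -/
inductive Cst (n : ℕ) : Type
  | step (r : Step)
  | recursor (Γ : List Ty) (τ : Ty) (h : τ.lev ≤ n + 1)
  | coder {S : Sequent} (D : Coder n S)

/-- The type of a constant. The recursor `rec_τ` is the constant for the rule with premisses
`Γ ⇒ τ` and `Γ, N, τ ⇒ τ` and conclusion `Γ, N ⇒ τ`. -/
def Cst.ty {n : ℕ} : Cst n → Ty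
  | .step r => r.ty
  | .recursor Γ τ _ =>
      arrows Γ τ ⇾ arrows (Γ ++ [.N, τ]) τ ⇾ arrows (Γ ++ [.N]) τ
  | .coder (S := S) _ => S.ty

/-- Typed variables in a context (a list of types). -/
inductive Var : List Ty → Ty → Type
  | zero {Ξ : List Ty} {σ : Ty} : Var (σ :: Ξ) σ
  | succ {Ξ : List Ty} {σ τ : Ty} : Var Ξ σ → Var (τ :: Ξ) σ

/-- Terms of a given type with free variables in the context `Ξ`. -/
inductive Term (n : ℕ) (Ξ : List Ty) : Ty → Type
  | var {σ : Ty} (x : Var Ξ σ) : Term n Ξ σ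
  | con (c : Cst n) : Term n Ξ c.ty
  | app {σ τ : Ty} (t : Term n Ξ (σ ⇾ τ)) (s : Term n Ξ σ) : Term n Ξ τ

infixl:75 " ⬝ " => Term.app

section
variable {n : ℕ} {Ξ Θ : List Ty}

/-- Transport along an equality of types. -/
def Term.cast {σ τ : Ty} (h : σ = τ) (t : Term n Ξ σ) : Term n Ξ τ := h ▸ t

/-- The constants that belong to the language of `T_{n+1}`: all steps other than `cond`, and the
recursors of level at most `n + 1`. -/
def Cst.InT : Cst n → Prop
  | .step (.cond _ _) => False
  | .step _ => True
  | .recursor _ _ _ => True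
  | .coder _ => False

/-- The terms that belong to the language of `T_{n+1}`. -/
def Term.InT {σ : Ty} : Term n Ξ σ → Prop
  | .var _ => True
  | .con c => c.InT
  | .app t s => t.InT ∧ s.InT

/-- A coderivation as a term. -/
def Coder.term {S : Sequent} (D : Coder n S) : Term n Ξ S.ty := .con (.coder D)

/-- A step as a term. -/
def stepT (r : Step) : Term n Ξ r.ty := .con (.step r)

/-- The numeral `0`. -/
def zeroT : Term n Ξ .N := .con (.step .zero)

/-- The successor of a term. -/
def succT (t : Term n Ξ .N) : Term n Ξ .N :=
  Term.app (σ := .N) (.con (.step .succ)) t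

/-- Lists of entries `F i₁, …, F iₖ` indexed by a list `[i₁, …, iₖ]`. -/
inductive HList {ι : Type} (F : ι → Type) : List ι → Type
  | nil : HList F []
  | cons {i : ι} {is : List ι} : F i → HList F is → HList F (i :: is)

/-- Concatenation. -/
def HList.append {ι : Type} {F : ι → Type} {is js : List ι} :
    HList F is → HList F js → HList F (is ++ js)
  | .nil, ys => ys
  | .cons x xs, ys => .cons x (xs.append ys)

/-- The list `xs, x`. -/
def HList.snoc {ι : Type} {F : ι → Type} {is : List ι} {i : ι}
    (xs : HList F is) (x : F i) : HList F (is ++ [i]) :=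
  xs.append (.cons x .nil)

/-- A vector of terms of the given types. -/
abbrev Args (n : ℕ) (Ξ : List Ty) : List Ty → Type := HList (Term n Ξ)

/-- The iterated application `t x₁ ⋯ xₖ`. -/
def Term.apps {Γ : List Ty} {τ : Ty} (t : Term n Ξ (arrows Γ τ)) : Args n Ξ Γ → Term n Ξ τ
  | .nil => t
  | .cons x xs => Term.apps (t ⬝ x) xs

/-- The trees underlying a list of coderivations. -/
def treesOf {Ss : List Sequent} : HList (Coder n) Ss → List CoTree
  | .nil => []
  | .cons D Ds => D.tree :: treesOf Ds

/-- A list of coderivations as a vector of terms. -/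
def termsOf {Ss : List Sequent} : HList (Coder n) Ss → Args n Ξ (Ss.map Sequent.ty)
  | .nil => .nil
  | .cons D Ds => .cons D.term (termsOf Ds)

/-- The equational axioms. The last one identifies a coderivation that concludes with the step `r`
and has immediate sub-coderivations `D₁, …, Dₖ` with the coterm `r D₁ ⋯ Dₖ`. -/
inductive EqAxiom (n : ℕ) (Ξ : List Ty) : {σ : Ty} → Term n Ξ σ → Term n Ξ σ → Prop
  | id (σ : Ty) (x : Term n Ξ σ) :
      EqAxiom n Ξ (Term.app (σ := σ) (τ := σ) (stepT (.id σ)) x) x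
  | ex (Γ : List Ty) (ρ σ : Ty) (Δ : List Ty) (τ : Ty)
      (t : Term n Ξ (arrows (Γ ++ σ :: ρ :: Δ) τ))
      (xs : Args n Ξ Γ) (x : Term n Ξ ρ) (y : Term n Ξ σ) (ys : Args n Ξ Δ) :
      EqAxiom n Ξ
        (Term.apps (Γ := Γ ++ ρ :: σ :: Δ) (stepT (.ex Γ ρ σ Δ τ) ⬝ t)
          (xs.append (.cons x (.cons y ys))))
        (t.apps (xs.append (.cons y (.cons x ys))))
  | wk (Γ : List Ty) (σ τ : Ty) (t : Term n Ξ (arrows Γ τ)) (xs : Args n Ξ Γ) (x : Term n Ξ σ) :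
      EqAxiom n Ξ
        (Term.apps (Γ := Γ ++ [σ]) (stepT (.wk Γ σ τ) ⬝ t) (xs.snoc x))
        (t.apps xs)
  | cntr (Γ : List Ty) (σ τ : Ty) (t : Term n Ξ (arrows (Γ ++ [σ, σ]) τ))
      (xs : Args n Ξ Γ) (x : Term n Ξ σ) :
      EqAxiom n Ξ
        (Term.apps (Γ := Γ ++ [σ]) (stepT (.cntr Γ σ τ) ⬝ t) (xs.snoc x))
        (t.apps (xs.append (.cons x (.cons x .nil))))
  | cut (Γ : List Ty) (σ τ : Ty) (s : Term n Ξ (arrows Γ σ))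
      (t : Term n Ξ (arrows (Γ ++ [σ]) τ)) (xs : Args n Ξ Γ) :
      EqAxiom n Ξ
        (Term.apps (Γ := Γ) (stepT (.cut Γ σ τ) ⬝ s ⬝ t) xs)
        (t.apps (xs.snoc (s.apps xs)))
  | L (Γ : List Ty) (ρ σ τ : Ty) (s : Term n Ξ (arrows Γ ρ))
      (t : Term n Ξ (arrows (Γ ++ [σ]) τ)) (xs : Args n Ξ Γ) (y : Term n Ξ (ρ ⇾ σ)) :
      EqAxiom n Ξ
        (Term.apps (Γ := Γ ++ [ρ ⇾ σ]) (stepT (.L Γ ρ σ τ) ⬝ s ⬝ t) (xs.snoc y))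
        (t.apps (xs.snoc (y ⬝ s.apps xs)))
  | R (Γ : List Ty) (σ τ : Ty) (t : Term n Ξ (arrows (Γ ++ [σ]) τ))
      (xs : Args n Ξ Γ) (x : Term n Ξ σ) :
      EqAxiom n Ξ
        (Term.apps (Γ := Γ) (τ := σ ⇾ τ) (stepT (.R Γ σ τ) ⬝ t) xs ⬝ x)
        (t.apps (xs.snoc x))
  | cond_zero (Γ : List Ty) (τ : Ty) (s : Term n Ξ (arrows Γ τ))
      (t : Term n Ξ (arrows (Γ ++ [.N]) τ)) (xs : Args n Ξ Γ) :
      EqAxiom n Ξ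
        (Term.apps (Γ := Γ ++ [.N]) (stepT (.cond Γ τ) ⬝ s ⬝ t) (xs.snoc zeroT))
        (s.apps xs)
  | cond_succ (Γ : List Ty) (τ : Ty) (s : Term n Ξ (arrows Γ τ))
      (t : Term n Ξ (arrows (Γ ++ [.N]) τ)) (xs : Args n Ξ Γ) (y : Term n Ξ .N) :
      EqAxiom n Ξ
        (Term.apps (Γ := Γ ++ [.N]) (stepT (.cond Γ τ) ⬝ s ⬝ t) (xs.snoc (succT y)))
        (t.apps (xs.snoc y))
  | rec_zero (Γ : List Ty) (τ : Ty) (h : τ.lev ≤ n + 1) (s : Term n Ξ (arrows Γ τ))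
      (t : Term n Ξ (arrows (Γ ++ [.N, τ]) τ)) (xs : Args n Ξ Γ) :
      EqAxiom n Ξ
        (Term.apps (Γ := Γ ++ [.N]) (.con (.recursor Γ τ h) ⬝ s ⬝ t) (xs.snoc zeroT))
        (s.apps xs)
  | rec_succ (Γ : List Ty) (τ : Ty) (h : τ.lev ≤ n + 1) (s : Term n Ξ (arrows Γ τ))
      (t : Term n Ξ (arrows (Γ ++ [.N, τ]) τ)) (xs : Args n Ξ Γ) (y : Term n Ξ .N) :
      EqAxiom n Ξ
        (Term.apps (Γ := Γ ++ [.N]) (.con (.recursor Γ τ h) ⬝ s ⬝ t) (xs.snoc (succT y)))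
        (t.apps (xs.append (.cons y (.cons
          (Term.apps (Γ := Γ ++ [.N]) (.con (.recursor Γ τ h) ⬝ s ⬝ t) (xs.snoc y)) .nil))))
  | unfold (r : Step) (D : Coder n r.concl) (Ds : HList (Coder n) r.premises)
      (h : D.tree = CoTree.node r (treesOf Ds)) :
      EqAxiom n Ξ D.term ((stepT r).apps (termsOf Ds))

/-! ### Substitution -/

/-- Renaming of variables. -/
def Term.rename (f : ∀ {σ : Ty}, Var Ξ σ → Var Θ σ) {σ : Ty} : Term n Ξ σ → Term n Θ σ
  | .var x => .var (f x)
  | .con c => .con c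
  | .app t s => .app (t.rename f) (s.rename f)

/-- The same term in a context with one more variable. -/
def Term.weaken {σ τ : Ty} (t : Term n Ξ τ) : Term n (σ :: Ξ) τ := t.rename Var.succ

/-- Simultaneous substitutions. -/
def Subst (n : ℕ) (Ξ Θ : List Ty) : Type := ∀ {σ : Ty}, Var Ξ σ → Term n Θ σ

/-- Extension of a substitution by a value for one more variable. -/
def Subst.extend (f : Subst n Ξ Θ) {τ : Ty} (t : Term n Θ τ) : Subst n (τ :: Ξ) Θ
  | _, .zero => t
  | _, .succ x => f x

/-- Passage of a substitution under a quantifier. -/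
def Subst.lift (f : Subst n Ξ Θ) {τ : Ty} : Subst n (τ :: Ξ) (τ :: Θ) :=
  Subst.extend (fun x => (f x).weaken) (.var .zero)

/-- Substitution in a term. -/
def Term.subst (f : Subst n Ξ Θ) {σ : Ty} : Term n Ξ σ → Term n Θ σ
  | .var x => f x
  | .con c => .con c
  | .app t s => .app (t.subst f) (s.subst f)

end

/-! ### Formulas -/

/-- Formulas with free variables in a context. -/
inductive Formula (n : ℕ) : List Ty → Type
  | eq {Ξ : List Ty} {σ : Ty} (s t : Term n Ξ σ) : Formula n Ξ
  | neg {Ξ : List Ty} (φ : Formula n Ξ) : Formula n Ξ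
  | and {Ξ : List Ty} (φ ψ : Formula n Ξ) : Formula n Ξ
  | or {Ξ : List Ty} (φ ψ : Formula n Ξ) : Formula n Ξ
  | imp {Ξ : List Ty} (φ ψ : Formula n Ξ) : Formula n Ξ
  | iff {Ξ : List Ty} (φ ψ : Formula n Ξ) : Formula n Ξ
  | all {Ξ : List Ty} (σ : Ty) (φ : Formula n (σ :: Ξ)) : Formula n Ξ
  | ex {Ξ : List Ty} (σ : Ty) (φ : Formula n (σ :: Ξ)) : Formula n Ξ

section
variable {n : ℕ}

/-- Substitution in a formula. -/
def Formula.subst : {Ξ Θ : List Ty} → Subst n Ξ Θ → Formula n Ξ → Formula n Θ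
  | _, _, f, .eq s t => .eq (s.subst f) (t.subst f)
  | _, _, f, .neg φ => .neg (φ.subst f)
  | _, _, f, .and φ ψ => .and (φ.subst f) (ψ.subst f)
  | _, _, f, .or φ ψ => .or (φ.subst f) (ψ.subst f)
  | _, _, f, .imp φ ψ => .imp (φ.subst f) (ψ.subst f)
  | _, _, f, .iff φ ψ => .iff (φ.subst f) (ψ.subst f)
  | _, _, f, .all σ φ => .all σ (φ.subst f.lift)
  | _, _, f, .ex σ φ => .ex σ (φ.subst f.lift)

/-- The same formula in a context with one more variable. -/
def Formula.weaken {Ξ : List Ty} {σ : Ty} (φ : Formula n Ξ) : Formula n (σ :: Ξ) :=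
  φ.subst fun x => .var (.succ x)

/-- `φ(t)`, where `φ` has a distinguished variable. -/
def Formula.inst {Ξ : List Ty} {σ : Ty} (φ : Formula n (σ :: Ξ)) (t : Term n Ξ σ) : Formula n Ξ :=
  φ.subst (Subst.extend (fun x => .var x) t)

/-- `φ(succ x)`, where `x` is the distinguished variable of `φ`. -/
def Formula.shift {Ξ : List Ty} (φ : Formula n (.N :: Ξ)) : Formula n (.N :: Ξ) :=
  φ.subst (Subst.extend (fun x => .var (.succ x)) (succT (.var .zero)))

/-- Quantifier-free formulas. -/
def Formula.QuantifierFree : {Ξ : List Ty} → Formula n Ξ → Prop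
  | _, .eq _ _ => True
  | _, .neg φ => φ.QuantifierFree
  | _, .and φ ψ => φ.QuantifierFree ∧ ψ.QuantifierFree
  | _, .or φ ψ => φ.QuantifierFree ∧ ψ.QuantifierFree
  | _, .imp φ ψ => φ.QuantifierFree ∧ ψ.QuantifierFree
  | _, .iff φ ψ => φ.QuantifierFree ∧ ψ.QuantifierFree
  | _, .all _ _ => False
  | _, .ex _ _ => False

/-- A truth assignment to formulas that respects the propositional connectives. -/
structure IsValuation {Ξ : List Ty} (v : Formula n Ξ → Prop) : Prop where
  neg : ∀ φ, v (.neg φ) ↔ ¬ v φ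
  and : ∀ φ ψ, v (.and φ ψ) ↔ (v φ ∧ v ψ)
  or : ∀ φ ψ, v (.or φ ψ) ↔ (v φ ∨ v ψ)
  imp : ∀ φ ψ, v (.imp φ ψ) ↔ (v φ → v ψ)
  iff : ∀ φ ψ, v (.iff φ ψ) ↔ (v φ ↔ v ψ)

/-- Substitution instances of classical propositional tautologies. -/
def Formula.IsTautology {Ξ : List Ty} (φ : Formula n Ξ) : Prop :=
  ∀ v : Formula n Ξ → Prop, IsValuation v → v φ

end

/-! ### The theory -/

/-- Provability in `C_n` extended by the recursors of level at most `n + 1`, of formulas with free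
variables in the context `Ξ`: classical first-order logic, the equality axioms, the extensionality
rule, the equational axioms for all constants, the axioms for `0` and successor, and the induction
rule for quantifier-free formulas. -/
inductive Provable (n : ℕ) : (Ξ : List Ty) → Formula n Ξ → Prop
  | taut {Ξ : List Ty} {φ : Formula n Ξ} (h : φ.IsTautology) : Provable n Ξ φ
  | mp {Ξ : List Ty} {φ ψ : Formula n Ξ} :
      Provable n Ξ (.imp φ ψ) → Provable n Ξ φ → Provable n Ξ ψ
  | all_elim {Ξ : List Ty} {σ : Ty} (φ : Formula n (σ :: Ξ)) (t : Term n Ξ σ) :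
      Provable n Ξ (.imp (.all σ φ) (φ.inst t))
  | all_intro {Ξ : List Ty} {σ : Ty} {ψ : Formula n Ξ} {φ : Formula n (σ :: Ξ)} :
      Provable n (σ :: Ξ) (.imp ψ.weaken φ) → Provable n Ξ (.imp ψ (.all σ φ))
  | ex_intro {Ξ : List Ty} {σ : Ty} (φ : Formula n (σ :: Ξ)) (t : Term n Ξ σ) :
      Provable n Ξ (.imp (φ.inst t) (.ex σ φ))
  | ex_elim {Ξ : List Ty} {σ : Ty} {φ : Formula n (σ :: Ξ)} {ψ : Formula n Ξ} :
      Provable n (σ :: Ξ) (.imp φ ψ.weaken) → Provable n Ξ (.imp (.ex σ φ) ψ)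
  | subst {Ξ Θ : List Ty} {φ : Formula n Ξ} (f : Subst n Ξ Θ) :
      Provable n Ξ φ → Provable n Θ (φ.subst f)
  | refl {Ξ : List Ty} {σ : Ty} (t : Term n Ξ σ) : Provable n Ξ (.eq t t)
  | leibniz {Ξ : List Ty} {σ : Ty} (s t : Term n Ξ σ) (φ : Formula n (σ :: Ξ)) :
      Provable n Ξ (.imp (.and (.eq s t) (φ.inst s)) (φ.inst t))
  | ext {Ξ : List Ty} {σ τ : Ty} {s t : Term n Ξ (σ ⇾ τ)} :
      Provable n (σ :: Ξ) (.eq (s.weaken ⬝ .var .zero) (t.weaken ⬝ .var .zero)) →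
        Provable n Ξ (.eq s t)
  | eqAxiom {Ξ : List Ty} {σ : Ty} {s t : Term n Ξ σ} (h : EqAxiom n Ξ s t) :
      Provable n Ξ (.eq s t)
  | succ_ne_zero {Ξ : List Ty} (t : Term n Ξ .N) : Provable n Ξ (.neg (.eq (succT t) zeroT))
  | succ_inj {Ξ : List Ty} (s t : Term n Ξ .N) :
      Provable n Ξ (.imp (.eq (succT s) (succT t)) (.eq s t))
  | ind {Ξ : List Ty} {φ : Formula n (.N :: Ξ)} (hφ : φ.QuantifierFree) :
      Provable n Ξ (φ.inst zeroT) → Provable n (.N :: Ξ) (.imp φ φ.shift) →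
        ∀ t : Term n Ξ .N, Provable n Ξ (φ.inst t)

end CircularT

open CircularT

/-!
The theorem is proved by a Kripke logical relation. A term is *derivable* if it is provably equal to
a coderivation of `C_n` applied to variables. Derivability at `N` induces, hereditarily along the
arrow types, the relation `Computable`. At types of level at most `n` the two notions agree
(`Computable.iff_derives`), because there the rules `cut`, `L` and `R` give application and
abstraction. Likewise, a function whose arguments and value have level at most `n` is computable
only if it has a coderivation whose antecedent lists its arguments (`Computable.derivesFun`), even
if its type has level `n + 1`. So it suffices that every term of `T_{n+1}` is computable
(`Term.InT.computable`), and this amounts to the computability of the constants. For all constants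
but the recursors it follows from their equations.

A recursor at a type `τ = ρs → N` of level `n + 1` is not available in `C_n`, but its arguments `ρs`
have level at most `n`. Given computable data `a` and `f`, the function `r` with `r 0 = a` and
`r (s y) = f y (r y)` is derived by a loop (`loopStep`): a coderivation `F` of `Γ, N, ρs ⇒ N` that
distinguishes cases by `cond`, derives `a` in the first case and `f y z` in the second, where `z` is
`F` itself, called at the same `Γ` and `y`. To make sense of `f y z` before `F` exists, `z` is
introduced as an unknown coderivation, an *oracle*. Hence the worlds of the relation consist of
variables and oracles, and derivations depend on the trees assigned to the oracles. The following
facts make the loop work.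

* A derivation inspects its oracles only as deep as the address at which it is evaluated, and one
  round of the loop is guarded, so that it has a fixed point (`CoTree.fix_eq`).
* Along each path from the root of a derivation to an oracle, all variables that precede the oracle
  are connected by immediate ancestry. In the loop, the variable of type `N` moreover passes through
  the principal position of `cond`, so that branches which take the loop infinitely often progress
  (`OpenDer.of_self`). All other branches progress by the assumption on the data, and finitely many
  distinct subtrees suffice.
* The term `r` and the loop satisfy the same recursion equations, and are therefore provably equal
  by induction on the equation `r y = F y` between terms of type `ρs → N` and extensionality
  (`PEq.of_recursion`, `derivesFun_of_recursion`).
-/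

namespace CircularT

/-! ### Trees and guarded fixed points -/

namespace CoTree

/-- Agreement of two trees at all addresses of length less than `m`. -/
def Agree (m : ℕ) (T U : CoTree) : Prop := ∀ a : List ℕ, a.length < m → T a = U a

theorem Agree.refl (m : ℕ) (T : CoTree) : Agree m T T := fun _ _ => rfl

theorem Agree.mono {m k : ℕ} {T U : CoTree} (h : Agree m T U) (hk : k ≤ m) : Agree k T U :=
  fun a ha => h a (by omega)

theorem Agree.node₁ {m : ℕ} {T U : CoTree} (h : Agree m T U) (r : Step) :
    Agree (m + 1) (node r [T]) (node r [U]) := by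
  rintro (_ | ⟨_ | i, a⟩) ha
  · rfl
  · exact h a (by simpa using ha)
  · rfl

theorem Agree.node₂ {m : ℕ} {T U T' U' : CoTree} (h : Agree m T U) (h' : Agree m T' U')
    (r : Step) : Agree (m + 1) (node r [T, T']) (node r [U, U']) := by
  rintro (_ | ⟨_ | _ | i, a⟩) ha
  · rfl
  · exact h a (by simpa using ha)
  · exact h' a (by simpa using ha)
  · rfl

/-- The tree without nodes. -/
def empty : CoTree := fun _ => none

/-- The fixed point of an operation on trees that is guarded, that is, determines its value one
level deeper than its argument. -/
def fix (G : CoTree → CoTree) : CoTree := fun a => G^[a.length + 1] empty a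

/-- The approximations from the empty tree are stable on ever longer addresses. -/
theorem fix_eq {G : CoTree → CoTree}
    (hG : ∀ m T U, Agree m T U → Agree (m + 1) (G T) (G U)) : fix G = G (fix G) := by
  have h1 : ∀ k, Agree k (G^[k] empty) (G^[k + 1] empty) := by
    intro k
    induction k with
    | zero => intro a ha; simp at ha
    | succ k ih =>
      rw [Function.iterate_succ_apply', Function.iterate_succ_apply' G (k + 1)]
      exact hG _ _ _ ih
  have h2 : ∀ k j, Agree k (G^[k] empty) (G^[k + j] empty) := by
    intro k j
    induction j with
    | zero => exact Agree.refl _ _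
    | succ j ih => exact fun a ha => (ih a ha).trans (h1 (k + j) a (by omega))
  have h3 : ∀ k, Agree k (G^[k] empty) (fix G) := by
    intro k a ha
    obtain ⟨j, rfl⟩ : ∃ j, k = a.length + 1 + j := ⟨k - (a.length + 1), by omega⟩
    exact (h2 (a.length + 1) j a (by omega)).symm
  refine funext fun a : List ℕ => ?_
  change G^[a.length + 1] empty a = _
  rw [Function.iterate_succ_apply']
  exact hG _ _ _ (h3 a.length) a (by omega)

theorem subtree_append (T : CoTree) (a b : List ℕ) :
    T.subtree (a ++ b) = (T.subtree a).subtree b := by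
  refine funext fun c : List ℕ => ?_
  simp [subtree]

theorem subtree_node {r : Step} {Us : List CoTree} {i : ℕ} {U : CoTree} (h : Us[i]? = some U)
    (a : List ℕ) : (node r Us).subtree (i :: a) = U.subtree a := by
  refine funext fun c : List ℕ => ?_
  simp [subtree, node, h]

end CoTree

/-! ### Threads along branches -/

/-- The branch `β` from its `k`th node on. -/
def shift (β : ℕ → ℕ) (k : ℕ) : ℕ → ℕ := fun m => β (k + m)

theorem branchAddr_add (β : ℕ → ℕ) (k m : ℕ) :
    branchAddr β (k + m) = branchAddr β k ++ branchAddr (shift β k) m := by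
  simp [branchAddr, List.range_add, shift, Function.comp_def]

theorem branchAddr_one (β : ℕ → ℕ) : branchAddr β 1 = [β 0] := by
  simp [branchAddr]

theorem CoTree.subtree_apply_shift (T : CoTree) (β : ℕ → ℕ) (k m : ℕ) :
    T.subtree (branchAddr β k) (branchAddr (shift β k) m) = T (branchAddr β (k + m)) := by
  rw [branchAddr_add]; rfl

theorem CoTree.IsBranch.shift {T : CoTree} {β : ℕ → ℕ} (h : T.IsBranch β) (k : ℕ) :
    (T.subtree (branchAddr β k)).IsBranch (shift β k) := by
  intro m
  rw [T.subtree_apply_shift]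
  exact h _

/-- The branch `β` of `T` has a thread that is infinitely often principal. -/
def ProgressesAlong (T : CoTree) (β : ℕ → ℕ) : Prop :=
  ∃ k p, T.IsThread β k p ∧
    ∀ l, ∃ m, l ≤ m ∧ k ≤ m ∧ ∃ r, T (branchAddr β m) = some r ∧ r.CondPrincipal (p m)

/-- Progress may start above the root. -/
theorem ProgressesAlong.of_shift {T : CoTree} {β : ℕ → ℕ} {k : ℕ}
    (h : ProgressesAlong (T.subtree (branchAddr β k)) (shift β k)) : ProgressesAlong T β := by
  obtain ⟨k₀, p, hp, hv⟩ := h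
  refine ⟨k + k₀, fun m => p (m - k), fun m hm => ?_, fun l => ?_⟩
  · obtain ⟨j, rfl⟩ : ∃ j, m = k + j := ⟨m - k, by omega⟩
    obtain ⟨r, hr, ha⟩ := hp j (by omega)
    rw [T.subtree_apply_shift] at hr
    refine ⟨r, hr, ?_⟩
    beta_reduce
    rw [show k + j + 1 - k = j + 1 by omega, show k + j - k = j by omega]
    exact ha
  · obtain ⟨m, h1, h2, r, hr, hc⟩ := hv l
    rw [T.subtree_apply_shift] at hr
    exact ⟨k + m, by omega, by omega, r, hr, by simpa using hc⟩

/-- The position `p` at the root of `T` leads to the position `q` at the `k`th node of the branch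
`β` along a path of immediate ancestry, which is principal for some `cond` step if `v` holds. -/
def Passes (T : CoTree) (β : ℕ → ℕ) (k p q : ℕ) (v : Prop) : Prop :=
  ∃ f : ℕ → ℕ, f 0 = p ∧ f k = q ∧
    (∀ m < k, ∃ r, T (branchAddr β m) = some r ∧ r.Ancestor (β m) (f m) (f (m + 1))) ∧
    (v → ∃ m < k, ∃ r, T (branchAddr β m) = some r ∧ r.CondPrincipal (f m))

theorem Passes.imp {T : CoTree} {β : ℕ → ℕ} {k p q : ℕ} {v w : Prop} (h : Passes T β k p q v)
    (hw : w → v) : Passes T β k p q w := by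
  obtain ⟨f, h0, h1, h2, h3⟩ := h
  exact ⟨f, h0, h1, h2, fun h => h3 (hw h)⟩

theorem Passes.trans {T : CoTree} {β : ℕ → ℕ} {k j p q s : ℕ} {v w : Prop}
    (h : Passes T β k p q v)
    (h' : Passes (T.subtree (branchAddr β k)) (shift β k) j q s w) :
    Passes T β (k + j) p s (v ∨ w) := by
  obtain ⟨f, f0, fk, fs, fv⟩ := h
  obtain ⟨f', f0', fk', fs', fv'⟩ := h'
  have e1 : ∀ m ≤ k, (if m < k then f m else f' (m - k)) = f m := by
    intro m hm
    split_ifs with h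
    · rfl
    · obtain rfl : m = k := by omega
      simp [f0', fk]
  have e2 : ∀ m, (if k + m < k then f (k + m) else f' (k + m - k)) = f' m := by
    intro m
    rw [if_neg (by omega)]; congr 1; omega
  refine ⟨fun m => if m < k then f m else f' (m - k), ?_, ?_, ?_, ?_⟩
  · dsimp only; rw [e1 0 (by omega), f0]
  · dsimp only; rw [e2 j, fk']
  · intro m hm
    dsimp only
    rcases Nat.lt_or_ge m k with h | h
    · rw [e1 m h.le, e1 (m + 1) h]; exact fs m h
    · obtain ⟨i, rfl⟩ : ∃ i, m = k + i := ⟨m - k, by omega⟩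
      rw [e2 i, Nat.add_assoc, e2 (i + 1), ← T.subtree_apply_shift]
      exact fs' i (by omega)
  · rintro (hv | hw)
    · obtain ⟨m, hm, h⟩ := fv hv
      refine ⟨m, by omega, ?_⟩
      dsimp only
      rw [e1 m hm.le]; exact h
    · obtain ⟨m, hm, h⟩ := fv' hw
      refine ⟨k + m, by omega, ?_⟩
      dsimp only
      rw [e2 m, ← T.subtree_apply_shift]; exact h

/-- Infinitely many finite paths of ancestry, each leading from the position `p₀` to itself and
visiting a principal position of a `cond` step, combine into a progressing thread. -/
theorem ProgressesAlong.of_segments {T : CoTree} {β : ℕ → ℕ} {p₀ : ℕ} (A : ℕ → Prop) (h0 : A 0)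
    (h : ∀ k, A k → ∃ d, A (k + d) ∧
      Passes (T.subtree (branchAddr β k)) (shift β k) d p₀ p₀ True) :
    ProgressesAlong T β := by
  have hseg : ∀ k : {k // A k}, ∃ (e : {k // A k}) (f : ℕ → ℕ), f k = p₀ ∧ f e = p₀ ∧
      (∀ m, k.1 ≤ m → m < e.1 → ∃ r, T (branchAddr β m) = some r ∧
        r.Ancestor (β m) (f m) (f (m + 1))) ∧
      ∃ m, k.1 ≤ m ∧ m < e.1 ∧ ∃ r, T (branchAddr β m) = some r ∧ r.CondPrincipal (f m) := by
    rintro ⟨k, hk⟩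
    obtain ⟨d, hd, f, f0, fd, fs, fv⟩ := h k hk
    refine ⟨⟨k + d, hd⟩, fun m => f (m - k), by simpa using f0, by simpa using fd, ?_, ?_⟩
    · intro m h1 h2
      obtain ⟨j, rfl⟩ : ∃ j, m = k + j := ⟨m - k, by simp at h1; omega⟩
      have := fs j (by simp at h2; omega)
      rw [T.subtree_apply_shift] at this
      beta_reduce
      rw [show k + j + 1 - k = j + 1 by omega, show k + j - k = j by omega]
      exact this
    · obtain ⟨m, hm, hr⟩ := fv trivial
      rw [T.subtree_apply_shift] at hr
      refine ⟨k + m, by simp, by simpa using hm, by simpa using hr⟩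
  choose e f fk fe fs fv using hseg
  have hlt : ∀ k, k.1 < (e k).1 := fun k => by
    obtain ⟨m, h1, h2, _⟩ := fv k; omega
  -- The start of the segment that is current at time `m`.
  let s : ℕ → {k // A k} := fun m =>
    Nat.rec ⟨0, h0⟩ (fun m k => if m + 1 < (e k).1 then k else e k) m
  have s_succ : ∀ m, s (m + 1) = if m + 1 < (e (s m)).1 then s m else e (s m) := fun m => rfl
  have hs : ∀ m, (s m).1 ≤ m ∧ m < (e (s m)).1 := by
    intro m
    induction m with
    | zero => exact ⟨le_rfl, (Nat.zero_le _).trans_lt (hlt _)⟩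
    | succ m ih =>
      rw [s_succ]
      split_ifs with h
      · exact ⟨by omega, h⟩
      · have : (e (s m)).1 = m + 1 := by omega
        exact ⟨by omega, by have := hlt (e (s m)); omega⟩
  have hstay : ∀ m j, m + j < (e (s m)).1 → s (m + j) = s m := by
    intro m j
    induction j with
    | zero => simp
    | succ j ih =>
      intro hj
      have := ih (by omega)
      rw [← Nat.add_assoc, s_succ, this, if_pos (by omega)]
  have hnext : ∀ m, s (e (s m)).1 = e (s m) := by
    intro m
    obtain ⟨j, hj⟩ : ∃ j, (e (s m)).1 = m + j + 1 := by
      have := (hs m).2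
      exact ⟨(e (s m)).1 - m - 1, by omega⟩
    rw [hj, s_succ, hstay m j (by omega), if_neg (by omega)]
  refine ⟨0, fun m => f (s m) m, fun m _ => ?_, fun l => ?_⟩
  · obtain ⟨r, hr, ha⟩ := fs (s m) m (hs m).1 (hs m).2
    refine ⟨r, hr, ?_⟩
    have : f (s (m + 1)) (m + 1) = f (s m) (m + 1) := by
      rw [s_succ]
      split_ifs with h
      · rfl
      · have h2 : (e (s m)).1 = m + 1 := by have := (hs m).2; omega
        rw [← h2, fk, fe]
    beta_reduce
    rw [this]; exact ha
  · set k := e (s l) with hk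
    obtain ⟨m, h1, h2, h3⟩ := fv k
    have hl : l < k.1 := (hs l).2
    have : s m = k := by
      obtain ⟨j, rfl⟩ : ∃ j, m = k.1 + j := ⟨m - k.1, by omega⟩
      have := hnext l
      rw [← hk] at this
      rw [hstay _ _ (by rw [this]; exact h2), this]
    refine ⟨m, by omega, by omega, ?_⟩
    beta_reduce
    rw [this]; exact h3

/-! ### Derivations with oracles -/

/-- All types of the sequent have level at most `n`. -/
def Sequent.LevLE (n : ℕ) (S : Sequent) : Prop := (∀ σ ∈ S.ant, σ.lev ≤ n) ∧ S.suc.lev ≤ n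

/-- A tree that may be used as a leaf, with the sequent that it is supposed to derive. Threads are
required for the positions below `len` in its antecedent. -/
structure Oracle : Type where
  tree : CoTree
  seq : Sequent
  len : ℕ

/-- The set of oracle trees with their sequents. -/
def oracleSet (O : List Oracle) : Set (CoTree × Sequent) := {x | ∃ E ∈ O, x = (E.tree, E.seq)}

/-- Every element of `X` is a tree with an inference step at the root whose conclusion is the
associated sequent and whose immediate subtrees are, with the premisses, in `Y`. -/
def LocallyCorrect (n : ℕ) (X Y : Set (CoTree × Sequent)) : Prop :=
  ∀ x ∈ X, ∃ (r : Step) (Us : List CoTree) (h : Us.length = r.premises.length),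
    x.1 = CoTree.node r Us ∧ r.concl = x.2 ∧ x.2.LevLE n ∧
      ∀ (i : ℕ) (hi : i < Us.length), (Us[i], r.premises[i]) ∈ Y

theorem LocallyCorrect.mono {n : ℕ} {X Y Z : Set (CoTree × Sequent)} (h : LocallyCorrect n X Y)
    (hYZ : Y ⊆ Z) : LocallyCorrect n X Z := by
  intro x hx
  obtain ⟨r, Us, hl, h1, h2, h3, h4⟩ := h x hx
  exact ⟨r, Us, hl, h1, h2, h3, fun i hi => hYZ (h4 i hi)⟩

theorem LocallyCorrect.union {n : ℕ} {X X' Y : Set (CoTree × Sequent)}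
    (h : LocallyCorrect n X Y) (h' : LocallyCorrect n X' Y) : LocallyCorrect n (X ∪ X') Y := by
  rintro x (hx | hx)
  · exact h x hx
  · exact h' x hx

/-- The tree `T` is a regular derivation of `S` with leaves among the oracles `O`: each of its
infinite branches progresses or enters an oracle `E`, and in the latter case, for each `p < E.len`,
the position `g p` at the root leads to the position `p` at the root of `E`, along a path that is
principal for some `cond` step if `v p` holds. If `u` holds, `T` is not itself just an oracle. -/
structure OpenDer (n : ℕ) (O : List Oracle) (S : Sequent) (g : ℕ → ℕ) (v : ℕ → Prop) (u : Prop)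
    (T : CoTree) : Prop where
  regular : ∃ X : Set (CoTree × Sequent), X.Finite ∧ LocallyCorrect n X (X ∪ oracleSet O) ∧
    ((T, S) ∈ X ∨ (¬ u ∧ (T, S) ∈ oracleSet O))
  progress : ∀ β, T.IsBranch β → ProgressesAlong T β ∨
    ∃ E ∈ O, ∃ k, T.subtree (branchAddr β k) = E.tree ∧
      ∀ p < E.len, Passes T β k (g p) p (v p)

namespace OpenDer

variable {n : ℕ} {O : List Oracle} {S : Sequent} {g : ℕ → ℕ} {v : ℕ → Prop} {u : Prop}
  {T : CoTree}

theorem weaken (h : OpenDer n O S g v u T) {g' : ℕ → ℕ} {v' : ℕ → Prop} {u' : Prop}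
    {O' : List Oracle} (hO : O ⊆ O')
    (hg : ∀ E ∈ O, ∀ p < E.len, g' p = g p) (hv : ∀ p, v' p → v p) (hu : u' → u) :
    OpenDer n O' S g' v' u' T := by
  have hs : oracleSet O ⊆ oracleSet O' := by
    rintro x ⟨E, hE, rfl⟩; exact ⟨E, hO hE, rfl⟩
  constructor
  · obtain ⟨X, hX, hl, hm⟩ := h.regular
    refine ⟨X, hX, hl.mono (Set.union_subset_union_right _ hs), ?_⟩
    rcases hm with hm | ⟨h1, h2⟩
    · exact .inl hm
    · exact .inr ⟨fun h => h1 (hu h), hs h2⟩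
  · intro β hβ
    rcases h.progress β hβ with hp | ⟨E, hE, k, hk, hp⟩
    · exact .inl hp
    · refine .inr ⟨E, hO hE, k, hk, fun p hp' => ?_⟩
      rw [hg E hE p hp']
      exact (hp p hp').imp (hv p)

/-- An oracle is a derivation. -/
theorem oracle {E : Oracle} (hE : E ∈ O) :
    OpenDer n O E.seq (fun p => p) (fun _ => False) False E.tree := by
  refine ⟨⟨∅, Set.finite_empty, fun _ h => h.elim, .inr ⟨id, E, hE, rfl⟩⟩, fun β _ =>
    .inr ⟨E, hE, 0, rfl, fun p _ => ⟨fun _ => p, rfl, rfl, by simp, False.elim⟩⟩⟩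

/-- An inference step applied to derivations. -/
theorem node {r : Step} {Us : List CoTree} (hlev : r.concl.LevLE n)
    (hlen : Us.length = r.premises.length)
    (h : ∀ (i : ℕ) (hi : i < Us.length), ∃ O' ⊆ O, ∃ g' v' u',
      OpenDer n O' (r.premises[i]) g' v' u' Us[i] ∧ ∀ E ∈ O', ∀ p < E.len,
        r.Ancestor i (g p) (g' p) ∧ (v p → v' p ∨ r.CondPrincipal (g p))) :
    OpenDer n O r.concl g v u (CoTree.node r Us) := by
  choose O' hO' g' v' u' hd ha using h
  have hs : ∀ i hi, oracleSet (O' i hi) ⊆ oracleSet O := by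
    rintro i hi x ⟨E, hE, rfl⟩; exact ⟨E, hO' i hi hE, rfl⟩
  constructor
  · choose X hX hl hm using fun (i : Fin Us.length) => (hd i i.2).regular
    refine ⟨insert (CoTree.node r Us, r.concl) (⋃ i, X i),
      (Set.finite_iUnion hX).insert _, ?_, .inl (Set.mem_insert _ _)⟩
    rintro x (rfl | hx)
    · refine ⟨r, Us, hlen, rfl, rfl, hlev, fun i hi => ?_⟩
      rcases hm ⟨i, hi⟩ with h | ⟨_, h⟩
      · exact .inl (.inr (Set.mem_iUnion.2 ⟨_, h⟩))
      · exact .inr (hs i hi h)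
    · obtain ⟨i, hi⟩ := Set.mem_iUnion.1 hx
      refine (hl i).mono ?_ x hi
      exact Set.union_subset_union ((Set.subset_iUnion X i).trans (Set.subset_insert _ _))
        (hs i i.2)
  · intro β hβ
    have h1 := hβ 1
    rw [branchAddr_one, CoTree.node] at h1
    have hi : β 0 < Us.length := by
      by_contra hc
      rw [List.getElem?_eq_none (by omega)] at h1
      simp at h1
    have hU : (CoTree.node r Us).subtree (branchAddr β 1) = Us[β 0] := by
      rw [branchAddr_one, CoTree.subtree_node (List.getElem?_eq_getElem hi)]; rfl
    have hb := hβ.shift 1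
    rw [hU] at hb
    rcases (hd _ hi).progress _ hb with hp | ⟨E, hE, k, hk, hp⟩
    · left
      rw [← hU] at hp
      exact hp.of_shift
    · refine .inr ⟨E, hO' _ hi hE, 1 + k, ?_, fun p hpE => ?_⟩
      · rw [branchAddr_add, CoTree.subtree_append, hU, hk]
      · obtain ⟨ha1, ha2⟩ := ha _ hi E hE p hpE
        have h2 : Passes (CoTree.node r Us) β 1 (g p) (g' _ hi p) (r.CondPrincipal (g p)) := by
          refine ⟨fun m => if m = 0 then g p else g' _ hi p, rfl, rfl, ?_, ?_⟩
          · intro m hm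
            obtain rfl : m = 0 := by omega
            exact ⟨r, rfl, ha1⟩
          · intro hc
            exact ⟨0, one_pos, r, rfl, hc⟩
        have h3 := hp p hpE
        rw [← hU] at h3
        exact (h2.trans h3).imp fun hv => (ha2 hv).symm

theorem node₀ {r : Step} (hr : r.premises = []) (hlev : r.concl.LevLE n) :
    OpenDer n O r.concl g v u (CoTree.node r []) :=
  node hlev (by simp [hr]) fun i hi => by simp at hi

theorem node₁ {r : Step} {P : Sequent} {U : CoTree} (hr : r.premises = [P])
    (hlev : r.concl.LevLE n) {g' : ℕ → ℕ} {v' : ℕ → Prop} {u' : Prop}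
    (h : OpenDer n O P g' v' u' U)
    (ha : ∀ E ∈ O, ∀ p < E.len,
      r.Ancestor 0 (g p) (g' p) ∧ (v p → v' p ∨ r.CondPrincipal (g p))) :
    OpenDer n O r.concl g v u (CoTree.node r [U]) :=
  node hlev (by simp [hr]) fun i hi => by
    obtain rfl : i = 0 := by simpa using hi
    exact ⟨O, List.Subset.refl O, g', v', u', by simpa [hr] using h, ha⟩

theorem node₂ {r : Step} {P P' : Sequent} {U U' : CoTree} (hr : r.premises = [P, P'])
    (hlev : r.concl.LevLE n) {O₀ O₁ : List Oracle} (hO₀ : O₀ ⊆ O)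
    (hO₁ : O₁ ⊆ O) {g₀ g₁ : ℕ → ℕ} {v₀ v₁ : ℕ → Prop} {u₀ u₁ : Prop}
    (h₀ : OpenDer n O₀ P g₀ v₀ u₀ U) (h₁ : OpenDer n O₁ P' g₁ v₁ u₁ U')
    (ha₀ : ∀ E ∈ O₀, ∀ p < E.len,
      r.Ancestor 0 (g p) (g₀ p) ∧ (v p → v₀ p ∨ r.CondPrincipal (g p)))
    (ha₁ : ∀ E ∈ O₁, ∀ p < E.len,
      r.Ancestor 1 (g p) (g₁ p) ∧ (v p → v₁ p ∨ r.CondPrincipal (g p))) :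
    OpenDer n O r.concl g v u (CoTree.node r [U, U']) :=
  node hlev (by simp [hr]) fun i hi => by
    obtain rfl | rfl : i = 0 ∨ i = 1 := by simp at hi; omega
    · exact ⟨O₀, hO₀, g₀, v₀, u₀, by simpa [hr] using h₀, ha₀⟩
    · exact ⟨O₁, hO₁, g₁, v₁, u₁, by simpa [hr] using h₁, ha₁⟩

/-- A derivation that uses itself as an oracle can dispense with it if it is guarded and each return
to the root passes through a principal position of a `cond` step. -/
theorem of_self {E : Oracle} (h : OpenDer n (E :: O) E.seq (fun p => p) v True E.tree) {p₀ : ℕ}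
    (hp₀ : p₀ < E.len) (hv : v p₀) (hO : ∀ E' ∈ O, E'.len ≤ E.len) :
    OpenDer n O E.seq (fun p => p) (fun _ => False) False E.tree := by
  constructor
  · obtain ⟨X, hX, hl, hm⟩ := h.regular
    have hm : (E.tree, E.seq) ∈ X := hm.resolve_right (by simp)
    refine ⟨X, hX, hl.mono ?_, .inl hm⟩
    rintro x (hx | ⟨E', hE', rfl⟩)
    · exact .inl hx
    · rcases List.mem_cons.1 hE' with rfl | hE'
      · exact .inl hm
      · exact .inr ⟨E', hE', rfl⟩
  · intro β hβ
    by_contra hcon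
    rw [not_or] at hcon
    obtain ⟨hnp, hne⟩ := hcon
    -- On a branch that neither progresses nor enters an oracle of `O`, the times of return to `E`
    -- are infinite in number, and each return provides one segment of a progressing thread.
    refine hnp (.of_segments (p₀ := p₀) (fun k => E.tree.subtree (branchAddr β k) = E.tree ∧
      ∀ p < E.len, Passes E.tree β k p p False) ⟨rfl, fun p _ =>
        ⟨fun _ => p, rfl, rfl, by simp, False.elim⟩⟩ ?_)
    rintro k ⟨hk, hpk⟩
    have hb := hβ.shift k
    rw [hk] at hb
    rcases h.progress _ hb with hp | ⟨E', hE', j, hj, hp⟩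
    · rw [← hk] at hp
      exact (hnp hp.of_shift).elim
    · have hj' : E.tree.subtree (branchAddr β (k + j)) = E'.tree := by
        rw [branchAddr_add, CoTree.subtree_append, hk, hj]
      have hp' : ∀ p < E'.len, p < E.len → Passes E.tree β (k + j) p p False := by
        intro p h1 h2
        have := hp p h1
        rw [← hk] at this
        exact ((hpk p h2).trans this).imp False.elim
      rcases List.mem_cons.1 hE' with rfl | hE'
      · refine ⟨j, ⟨hj', fun p h1 => hp' p h1 h1⟩, ?_⟩
        have := hp _ hp₀
        rw [← hk] at this
        rw [hk] at this ⊢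
        exact this.imp fun _ => hv
      · exact (hne ⟨E', hE', k + j, hj', fun p h1 => hp' p h1 (h1.trans_le (hO _ hE'))⟩).elim

/-- Oracles that have derivations can be dispensed with. -/
theorem close (h : OpenDer n O S g v u T)
    (hO : ∀ E ∈ O, OpenDer n [] E.seq (fun p => p) (fun _ => False) False E.tree) :
    OpenDer n [] S (fun p => p) (fun _ => False) False T := by
  have e : oracleSet [] = ∅ := by ext; simp [oracleSet]
  constructor
  · obtain ⟨X, hX, hl, hm⟩ := h.regular
    choose Y hY hYl hYm using fun E : {E // E ∈ O} => (hO E.1 E.2).regular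
    simp only [e, Set.mem_empty_iff_false, and_false, or_false, Set.union_empty] at hYm hYl ⊢
    have hsub : oracleSet O ⊆ ⋃ E, Y E := by
      rintro x ⟨E, hE, rfl⟩
      exact Set.mem_iUnion.2 ⟨⟨E, hE⟩, hYm ⟨E, hE⟩⟩
    have : Finite {E // E ∈ O} := List.finite_toSet O
    refine ⟨X ∪ ⋃ E, Y E, hX.union (Set.finite_iUnion hY), ?_, ?_⟩
    · refine (hl.mono (Set.union_subset_union_right _ hsub)).union ?_
      intro x hx
      obtain ⟨E, hE⟩ := Set.mem_iUnion.1 hx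
      exact (hYl E).mono ((Set.subset_iUnion Y E).trans Set.subset_union_right) x hE
    · rcases hm with hm | ⟨_, hm⟩
      · exact .inl hm
      · exact .inr (hsub hm)
  · intro β hβ
    rcases h.progress β hβ with hp | ⟨E, hE, k, hk, -⟩
    · exact .inl hp
    · left
      have hb := hβ.shift k
      rw [hk] at hb
      rcases (hO E hE).progress _ hb with hp | ⟨E', hE', -⟩
      · rw [← hk] at hp
        exact hp.of_shift
      · simp at hE'

/-- A derivation without oracles is a coderivation. -/
theorem exists_coder (h : OpenDer n [] S g v u T) : ∃ C : Coder n S, C.tree = T := by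
  have e : oracleSet [] = ∅ := by ext; simp [oracleSet]
  obtain ⟨X, hX, hl, hm⟩ := h.regular
  simp only [e, Set.mem_empty_iff_false, and_false, or_false, Set.union_empty] at hm hl
  have hroot : ∀ x ∈ X, (x.1 []).map Step.concl = some x.2 := by
    intro x hx
    obtain ⟨r, Us, _, h1, h2, _⟩ := hl x hx
    rw [h1, ← h2]; rfl
  have hsub : ∀ (a : List ℕ), ∀ x ∈ X, (x.1 a).isSome → ∃ S', (x.1.subtree a, S') ∈ X := by
    intro a
    induction a with
    | nil => exact fun x hx _ => ⟨x.2, hx⟩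
    | cons i a ih =>
      intro x hx ha
      obtain ⟨r, Us, hlen, h1, _, _, h4⟩ := hl x hx
      rw [h1, CoTree.node] at ha
      have hi : i < Us.length := by
        by_contra hc
        rw [List.getElem?_eq_none (by omega)] at ha
        simp at ha
      rw [List.getElem?_eq_getElem hi] at ha
      rw [h1, CoTree.subtree_node (List.getElem?_eq_getElem hi)]
      exact ih _ (h4 i hi) ha
  have hcor : ∀ (a : List ℕ), ∀ x ∈ X, ∀ i,
      (x.1 (a ++ [i])).map Step.concl = (x.1 a).bind fun r => r.premises[i]? := by
    intro a
    induction a with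
    | nil =>
      intro x hx i
      obtain ⟨r, Us, hlen, h1, _, _, h4⟩ := hl x hx
      rw [h1]
      simp only [List.nil_append, CoTree.node, Option.bind_some]
      rcases Nat.lt_or_ge i Us.length with hi | hi
      · rw [List.getElem?_eq_getElem hi, List.getElem?_eq_getElem (by omega)]
        exact hroot _ (h4 i hi)
      · rw [List.getElem?_eq_none hi, List.getElem?_eq_none (by omega)]
        rfl
    | cons j a ih =>
      intro x hx i
      obtain ⟨r, Us, hlen, h1, _, _, h4⟩ := hl x hx
      rw [h1]
      simp only [List.cons_append, CoTree.node]
      rcases Nat.lt_or_ge j Us.length with hi | hi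
      · rw [List.getElem?_eq_getElem hi]
        exact ih _ (h4 j hi) i
      · rw [List.getElem?_eq_none hi]
        rfl
  refine ⟨⟨T, ⟨hroot _ hm, fun a i => hcor a _ hm i⟩, ?_, ?_, ?_⟩, rfl⟩
  · intro a r hr
    obtain ⟨S', hS'⟩ := hsub a _ hm (by simp [hr])
    obtain ⟨r', Us, _, h1, h2, h3, _⟩ := hl _ hS'
    have : T a = some r' := by
      have := congrArg (fun U : CoTree => U []) h1
      simpa [CoTree.subtree, CoTree.node] using this
    rw [hr] at this
    obtain rfl := Option.some.inj this
    rw [h2]; exact h3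
  · refine (hX.image Prod.fst).subset ?_
    rintro U ⟨a, ha, rfl⟩
    obtain ⟨S', hS'⟩ := hsub a _ hm ha
    exact ⟨_, hS', rfl⟩
  · intro β hβ
    rcases h.progress β hβ with hp | ⟨E, hE, _⟩
    · exact hp
    · simp at hE

end OpenDer

/-! ### Subtrees of coderivations -/

namespace Coder

variable {n : ℕ}

theorem ext {S : Sequent} {C D : Coder n S} (h : C.tree = D.tree) : C = D := by
  cases C; cases D; cases h; rfl

/-- The subtrees of a coderivation are coderivations. -/
theorem exists_subtree {S P : Sequent} (C : Coder n S) {a : List ℕ}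
    (ha : (C.tree a).map Step.concl = some P) : ∃ D : Coder n P, D.tree = C.tree.subtree a := by
  have hsub : ∀ b, C.tree.subtree a b = C.tree (a ++ b) := fun _ => rfl
  refine ⟨⟨C.tree.subtree a, ⟨by rw [hsub, List.append_nil]; exact ha, fun b i => ?_⟩, ?_, ?_, ?_⟩,
    rfl⟩
  · rw [hsub, hsub, ← List.append_assoc]
    exact C.isCoderivation.correct _ _
  · intro b r hr
    exact C.levelLE _ r hr
  · refine C.regular.subset ?_
    rintro U ⟨b, hb, rfl⟩
    exact ⟨a ++ b, hb, (C.tree.subtree_append a b).symm⟩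
  · intro β hβ
    -- Precede the branch by the address of the subtree.
    let β' : ℕ → ℕ := fun m => if h : m < a.length then a[m] else β (m - a.length)
    have h1 : branchAddr β' a.length = a := by
      refine List.ext_getElem (by simp [branchAddr]) fun i hi hi' => ?_
      simp [branchAddr, β', hi']
    have h2 : shift β' a.length = β := by
      funext m
      simp [shift, β']
    have h3 : ∀ m, C.tree (branchAddr β' (a.length + m)) = C.tree.subtree a (branchAddr β m) := by
      intro m
      rw [branchAddr_add, h1, h2]; rfl
    have hpre : ∀ (b : List ℕ) (i : ℕ), (C.tree (b ++ [i])).isSome → (C.tree b).isSome := by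
      intro b i hb
      have := C.isCoderivation.correct b i
      by_contra hc
      rw [Option.not_isSome_iff_eq_none] at hc
      rw [hc] at this
      simp at this
      simp [this] at hb
    have hbr : C.tree.IsBranch β' := by
      intro k
      rcases Nat.lt_or_ge k a.length with hk | hk
      · have hlow : ∀ j, (C.tree (branchAddr β' (a.length - j))).isSome := by
          intro j
          induction j with
          | zero =>
            have := h3 0
            rw [Nat.add_zero] at this
            rw [Nat.sub_zero, this]
            exact hβ 0
          | succ j ih =>
            rcases Nat.lt_or_ge j a.length with hj | hj
            · rw [show a.length - j = a.length - (j + 1) + 1 by omega, branchAddr_add] at ih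
              rw [branchAddr_one] at ih
              exact hpre _ _ ih
            · rwa [show a.length - (j + 1) = a.length - j by omega]
        have := hlow (a.length - k)
        rwa [show a.length - (a.length - k) = k by omega] at this
      · obtain ⟨m, rfl⟩ : ∃ m, k = a.length + m := ⟨k - a.length, by omega⟩
        rw [h3]; exact hβ m
    obtain ⟨k, p, hp, hv⟩ := C.progressing β' hbr
    refine ⟨k, fun m => p (a.length + m), fun m hm => ?_, fun l => ?_⟩
    · obtain ⟨r, hr, hA⟩ := hp (a.length + m) (by omega)
      rw [h3] at hr
      refine ⟨r, hr, ?_⟩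
      have : β' (a.length + m) = β m := congrFun h2 m
      rw [this] at hA
      exact hA
    · obtain ⟨m, h4, h5, r, hr, hc⟩ := hv (a.length + max l k)
      obtain ⟨j, rfl⟩ : ∃ j, m = a.length + j := ⟨m - a.length, by omega⟩
      rw [h3] at hr
      exact ⟨j, by omega, by omega, r, hr, hc⟩

/-- A coderivation is a derivation without oracles. -/
theorem openDer {S : Sequent} (C : Coder n S) :
    OpenDer n [] S (fun p => p) (fun _ => False) False C.tree := by
  have hpre : ∀ (a : List ℕ) (r : Step), C.tree a = some r → C.tree.subtree a =
      CoTree.node r ((List.range r.premises.length).map fun i => C.tree.subtree (a ++ [i])) := by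
    intro a r hr
    refine funext fun b : List ℕ => ?_
    rcases b with _ | ⟨i, b⟩
    · simpa [CoTree.subtree, CoTree.node] using hr
    · rcases Nat.lt_or_ge i r.premises.length with hi | hi
      · simp [CoTree.node, CoTree.subtree, List.getElem?_range hi]
      · have h1 : C.tree (a ++ [i]) = none := by
          have := C.isCoderivation.correct a i
          rw [hr] at this
          simpa [List.getElem?_eq_none hi] using this
        have h2 : ∀ b : List ℕ, C.tree (a ++ [i] ++ b) = none := by
          intro b
          induction b using List.reverseRecOn with
          | nil => simpa using h1
          | append_singleton b j ih =>
            have := C.isCoderivation.correct (a ++ [i] ++ b) j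
            rw [ih] at this
            simpa using this
        have h3 := h2 b
        simp only [CoTree.node, CoTree.subtree]
        rw [List.getElem?_eq_none (by simpa using hi)]
        simpa using h3
  refine ⟨⟨{x | ∃ a r, C.tree a = some r ∧ x = (C.tree.subtree a, r.concl)}, ?_, ?_, ?_⟩,
    fun β hβ => .inl (C.progressing β hβ)⟩
  · refine (C.regular.image fun U => (U, ((U []).map Step.concl).getD S)).subset ?_
    rintro x ⟨a, r, hr, rfl⟩
    refine ⟨_, ⟨a, by simp [hr], rfl⟩, ?_⟩
    simp [CoTree.subtree, hr]
  · rintro x ⟨a, r, hr, rfl⟩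
    refine ⟨r, _, by simp, hpre a r hr, rfl, C.levelLE a r hr, fun i hi => .inl ?_⟩
    simp only [List.length_map, List.length_range] at hi
    have := C.isCoderivation.correct a i
    rw [hr, Option.bind_some, List.getElem?_eq_getElem hi] at this
    obtain ⟨r', hr', he⟩ := Option.map_eq_some_iff.1 this
    exact ⟨a ++ [i], r', hr', by simp [he]⟩
  · left
    obtain ⟨r, hr, he⟩ := Option.map_eq_some_iff.1 C.isCoderivation.root
    exact ⟨[], r, hr, by rw [he]; rfl⟩

end Coder

/-! ### Renaming and substitution -/

section

variable {n : ℕ} {Ξ Θ Λ : List Ty}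

/-- The identity substitution. -/
def idSubst (n : ℕ) (Ξ : List Ty) : Subst n Ξ Ξ := fun x => .var x

theorem Term.subst_idSubst {σ : Ty} (t : Term n Ξ σ) : t.subst (idSubst n Ξ) = t := by
  induction t with
  | var x => rfl
  | con c => rfl
  | app t s iht ihs => simp only [Term.subst, iht, ihs]

theorem Term.subst_rename (g : ∀ {σ : Ty}, Var Ξ σ → Var Θ σ) (f : Subst n Θ Λ) {σ : Ty}
    (t : Term n Ξ σ) : (t.rename g).subst f = t.subst (fun x => f (g x)) := by
  induction t with
  | var x => rfl
  | con c => rfl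
  | app t s iht ihs => simp only [Term.subst, Term.rename, iht, ihs]

theorem Term.subst_weaken {σ τ : Ty} (t : Term n Ξ τ) (f : Subst n (σ :: Ξ) Λ) :
    t.weaken.subst f = t.subst (fun x => f x.succ) :=
  t.subst_rename _ f

@[simp] theorem Term.subst_weaken_extend {σ τ : Ty} (t : Term n Ξ τ) (f : Subst n Ξ Λ)
    (s : Term n Λ σ) : t.weaken.subst (f.extend s) = t.subst f :=
  t.subst_weaken _

@[simp] theorem Term.subst_weaken_extend_var {σ τ : Ty} (t : Term n Ξ τ) (s : Term n Ξ σ) :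
    t.weaken.subst (Subst.extend (fun x => .var x) s) = t :=
  (t.subst_weaken _).trans t.subst_idSubst

theorem Term.weaken_eq_subst {σ τ : Ty} (t : Term n Ξ τ) :
    (t.weaken : Term n (σ :: Ξ) τ) = t.subst (fun x => .var x.succ) := by
  rw [← Term.subst_idSubst t.weaken, Term.subst_weaken]; rfl

/-! ### Derived rules for equality -/

/-- Provability of an equation. -/
abbrev PEq {σ : Ty} (s t : Term n Ξ σ) : Prop := Provable n Ξ (.eq s t)

namespace PEq

/-- Leibniz's law as a rule. The formula `φ` marks the occurrences that are replaced. -/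
theorem leibniz_of {σ : Ty} {s t : Term n Ξ σ} (h : PEq s t) (φ : Formula n (σ :: Ξ))
    (hφ : Provable n Ξ (φ.inst s)) : Provable n Ξ (φ.inst t) := by
  refine .mp (.mp (.mp (.taut ?_) (.leibniz s t φ)) h) hφ
  intro v hv
  simp only [hv.imp, hv.and]
  tauto

theorem imp_rewrite {σ : Ty} {s t : Term n Ξ σ} (h : PEq s t) (φ : Formula n (σ :: Ξ))
    {χ : Formula n Ξ} (hφ : Provable n Ξ (.imp χ (φ.inst s))) :
    Provable n Ξ (.imp χ (φ.inst t)) := by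
  refine .mp (.mp (.mp (.taut ?_) (.leibniz s t φ)) h) hφ
  intro v hv
  simp only [hv.imp, hv.and]
  tauto

theorem refl {σ : Ty} (t : Term n Ξ σ) : PEq t t := Provable.refl t

theorem of_eq {σ : Ty} {s t : Term n Ξ σ} (h : s = t) : PEq s t := h ▸ Provable.refl s

theorem symm {σ : Ty} {s t : Term n Ξ σ} (h : PEq s t) : PEq t s := by
  have := h.leibniz_of (.eq (.var .zero) s.weaken)
  simp only [Formula.inst, Formula.subst, Term.subst_weaken_extend_var] at this
  exact this (refl s)

theorem trans {σ : Ty} {s t u : Term n Ξ σ} (h : PEq s t) (h' : PEq t u) : PEq s u := by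
  have := h'.leibniz_of (.eq s.weaken (.var .zero))
  simp only [Formula.inst, Formula.subst, Term.subst_weaken_extend_var] at this
  exact this h

theorem app {σ τ : Ty} {s s' : Term n Ξ (σ ⇾ τ)} {t t' : Term n Ξ σ} (h : PEq s s')
    (h' : PEq t t') : PEq (s ⬝ t) (s' ⬝ t') := by
  have h1 := h.leibniz_of (.eq (s.weaken ⬝ t.weaken) (.var .zero ⬝ t.weaken))
  have h2 := h'.leibniz_of (.eq (s'.weaken ⬝ t.weaken) (s'.weaken ⬝ .var .zero))
  simp only [Formula.inst, Formula.subst, Term.subst, Term.subst_weaken_extend_var] at h1 h2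
  exact trans (h1 (refl _)) (h2 (refl _))

theorem subst {σ : Ty} {s t : Term n Ξ σ} (h : PEq s t) (f : Subst n Ξ Θ) :
    PEq (s.subst f) (t.subst f) :=
  Provable.subst f h

theorem weaken {σ τ : Ty} {s t : Term n Ξ σ} (h : PEq s t) :
    PEq (s.weaken : Term n (τ :: Ξ) σ) t.weaken := by
  rw [Term.weaken_eq_subst, Term.weaken_eq_subst]
  exact h.subst _

theorem _root_.CircularT.Provable.imp_congr_app {σ τ : Ty} (f : Term n Ξ (σ ⇾ τ))
    (s t : Term n Ξ σ) : Provable n Ξ (.imp (.eq s t) (.eq (f ⬝ s) (f ⬝ t))) := by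
  have h := Provable.leibniz s t (.eq (f ⬝ s).weaken (f.weaken ⬝ .var .zero))
  simp only [Formula.inst, Formula.subst, Term.subst, Term.subst_weaken_extend_var] at h
  refine .mp (.mp (.taut ?_) h) (refl (f ⬝ s))
  intro v hv
  simp only [hv.imp, hv.and]
  exact fun h1 h2 h3 => h1 ⟨h3, h2⟩

/-- Induction on the equation `s x = t x`. -/
theorem app_eq_of_recursion {τ : Ty} {s t : Term n Ξ (.N ⇾ τ)} {a : Term n Ξ τ}
    {f : Term n Ξ (.N ⇾ τ ⇾ τ)} (hs₀ : PEq (s ⬝ zeroT) a) (ht₀ : PEq (t ⬝ zeroT) a)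
    (hs : PEq (Ξ := .N :: Ξ) (s.weaken ⬝ succT (.var .zero))
      (f.weaken ⬝ .var .zero ⬝ (s.weaken ⬝ .var .zero)))
    (ht : PEq (Ξ := .N :: Ξ) (t.weaken ⬝ succT (.var .zero))
      (f.weaken ⬝ .var .zero ⬝ (t.weaken ⬝ .var .zero))) (u : Term n Ξ .N) :
    PEq (s ⬝ u) (t ⬝ u) := by
  let φ : Formula n (.N :: Ξ) := .eq (s.weaken ⬝ .var .zero) (t.weaken ⬝ .var .zero)
  have hinst : ∀ u, φ.inst u = .eq (s ⬝ u) (t ⬝ u) := by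
    intro u
    simp only [φ, Formula.inst, Formula.subst, Term.subst, Term.subst_weaken_extend_var]
    rfl
  have h1 : Provable n (.N :: Ξ) (.imp φ φ.shift) := by
    have hsh : φ.shift =
        .eq (s.weaken ⬝ succT (.var .zero)) (t.weaken ⬝ succT (.var .zero)) := by
      have e : ∀ s : Term n Ξ (.N ⇾ τ), s.weaken.subst (Subst.extend (fun x => .var (.succ x))
          (succT (.var .zero))) = s.weaken := fun s =>
        (s.subst_weaken _).trans s.weaken_eq_subst.symm
      simp only [φ, Formula.shift, Formula.subst, Term.subst, e]
      rfl
    rw [hsh]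
    -- From `s x = t x` follows `f x (s x) = f x (t x)`, and both sides are rewritten.
    have e0 := Provable.imp_congr_app (f.weaken ⬝ .var .zero)
      (s.weaken ⬝ .var .zero) (t.weaken ⬝ .var .zero)
    have e1 := hs.symm.imp_rewrite (.eq (.var .zero)
      (f.weaken ⬝ .var .zero ⬝ (t.weaken ⬝ .var .zero)).weaken) (χ := φ)
    have e2 := ht.symm.imp_rewrite
      (.eq (s.weaken ⬝ succT (.var .zero)).weaken (.var .zero)) (χ := φ)
    simp only [Formula.inst, Formula.subst, Term.subst, Term.subst_weaken_extend_var] at e1 e2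
    exact e2 (e1 e0)
  have h := Provable.ind (φ := φ) trivial (by rw [hinst]; exact hs₀.trans ht₀.symm) h1 u
  rwa [hinst] at h

/-- Functions on `N` that satisfy the same recursion equations are equal. -/
theorem of_recursion {τ : Ty} {s t : Term n Ξ (.N ⇾ τ)} {a : Term n Ξ τ}
    {f : Term n Ξ (.N ⇾ τ ⇾ τ)} (hs₀ : PEq (s ⬝ zeroT) a) (ht₀ : PEq (t ⬝ zeroT) a)
    (hs : PEq (Ξ := .N :: Ξ) (s.weaken ⬝ succT (.var .zero))
      (f.weaken ⬝ .var .zero ⬝ (s.weaken ⬝ .var .zero)))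
    (ht : PEq (Ξ := .N :: Ξ) (t.weaken ⬝ succT (.var .zero))
      (f.weaken ⬝ .var .zero ⬝ (t.weaken ⬝ .var .zero))) : PEq s t := by
  have e : ∀ {σ : Ty} (s : Term n Ξ σ), s.weaken.subst (Subst.extend
      (fun x => .var x.succ.succ) (.var .zero) : Subst n (.N :: Ξ) (.N :: .N :: Ξ)) =
        s.weaken.weaken := by
    intro σ s
    have h := s.subst_weaken (σ := .N) (fun x => .var x.succ : Subst n (.N :: Ξ) (.N :: .N :: Ξ))
    rw [← Term.weaken_eq_subst] at h
    exact (s.subst_weaken _).trans h.symm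
  have key : ∀ {s : Term n Ξ (.N ⇾ τ)}, PEq (Ξ := .N :: Ξ) (s.weaken ⬝ succT (.var .zero))
      (f.weaken ⬝ .var .zero ⬝ (s.weaken ⬝ .var .zero)) →
      PEq (Ξ := .N :: .N :: Ξ) (s.weaken.weaken ⬝ succT (.var .zero))
        (f.weaken.weaken ⬝ .var .zero ⬝ (s.weaken.weaken ⬝ .var .zero)) := by
    intro s hs
    have h := hs.subst (Subst.extend (fun x => .var x.succ.succ) (.var .zero) :
      Subst n (.N :: Ξ) (.N :: .N :: Ξ))
    simp only [Term.subst, e] at h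
    exact h
  exact .ext (app_eq_of_recursion hs₀.weaken ht₀.weaken (key hs) (key ht) (.var .zero))

end PEq

end

/-! ### Vectors of terms -/

theorem arrows_append (Γ Δ : List Ty) (τ : Ty) :
    arrows (Γ ++ Δ) τ = arrows Γ (arrows Δ τ) := by
  induction Γ with
  | nil => rfl
  | cons σ Γ ih => simp [arrows, ih]

namespace HList

variable {ι : Type} {F : ι → Type}

/-- Transport along an equality of index lists. -/
def cast {is js : List ι} (h : is = js) (xs : HList F is) : HList F js := h ▸ xs

theorem cons_cast {i : ι} {is js : List ι} (h : is = js) (x : F i) (xs : HList F is) :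
    (HList.cons x xs).cast (congrArg (i :: ·) h) = .cons x (xs.cast h) := by
  subst h; rfl

theorem snoc_append {is js : List ι} {i : ι} (xs : HList F is) (x : F i) (ys : HList F js) :
    (xs.snoc x).append ys =
      (xs.append (.cons x ys)).cast (List.append_cons is i js) := by
  induction xs with
  | nil => rfl
  | cons y xs ih =>
    rw [HList.append, cons_cast (List.append_cons _ i js), ← ih]
    rfl

theorem append_snoc {is js : List ι} {i : ι} (xs : HList F is) (ys : HList F js) (x : F i) :
    (xs.append ys).snoc x =
      (xs.append (ys.snoc x)).cast (List.append_assoc is js [i]).symm := by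
  induction xs with
  | nil => rfl
  | cons y xs ih =>
    rw [HList.append, HList.append, cons_cast (List.append_assoc _ js [i]).symm, ← ih]
    rfl

theorem append_nil {is : List ι} (xs : HList F is) :
    (xs.append .nil).cast (List.append_nil is) = xs := by
  induction xs with
  | nil => rfl
  | cons x xs ih => rw [HList.append, cons_cast (List.append_nil _), ih]

theorem exists_append {is js : List ι} (xs : HList F (is ++ js)) :
    ∃ (ys : HList F is) (zs : HList F js), xs = ys.append zs := by
  induction is with
  | nil => exact ⟨.nil, xs, rfl⟩
  | cons i is ih =>
    rcases xs with _ | ⟨x, xs⟩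
    obtain ⟨ys, zs, rfl⟩ := ih xs
    exact ⟨.cons x ys, zs, rfl⟩

end HList

section

variable {n : ℕ} {Ξ Θ Λ : List Ty}

/-- Substitution in a vector of terms. -/
def Args.subst (f : Subst n Ξ Θ) : {Γ : List Ty} → Args n Ξ Γ → Args n Θ Γ
  | _, .nil => .nil
  | _, .cons x xs => .cons (x.subst f) (Args.subst f xs)

theorem Args.subst_append (f : Subst n Ξ Θ) {Γ Δ : List Ty} (xs : Args n Ξ Γ) (ys : Args n Ξ Δ) :
    Args.subst f (xs.append ys) = (Args.subst f xs).append (Args.subst f ys) := by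
  induction xs with
  | nil => rfl
  | cons x xs ih => simp only [HList.append, Args.subst, ih]

theorem Args.subst_snoc (f : Subst n Ξ Θ) {Γ : List Ty} {σ : Ty} (xs : Args n Ξ Γ)
    (x : Term n Ξ σ) : Args.subst f (xs.snoc x) = (Args.subst f xs).snoc (x.subst f) :=
  Args.subst_append f xs _

theorem Args.subst_idSubst {Γ : List Ty} (xs : Args n Ξ Γ) :
    Args.subst (idSubst n Ξ) xs = xs := by
  induction xs with
  | nil => rfl
  | cons x xs ih => exact congrArg₂ HList.cons (Term.subst_idSubst x) ih

theorem Args.subst_subst_succ {σ : Ty} (f : Subst n (σ :: Ξ) Θ) {Γ : List Ty}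
    (xs : Args n Ξ Γ) :
    Args.subst f (Args.subst (fun x => .var x.succ : Subst n Ξ (σ :: Ξ)) xs) =
      Args.subst (fun x => f x.succ) xs := by
  induction xs with
  | nil => rfl
  | cons x xs ih =>
    have e : (x.subst (fun x => .var x.succ : Subst n Ξ (σ :: Ξ))).subst f =
        x.subst (fun x => f x.succ) := by
      rw [← Term.weaken_eq_subst, Term.subst_weaken]
    simp only [Args.subst, ih, e]

theorem Term.subst_apps (f : Subst n Ξ Θ) {Γ : List Ty} {τ : Ty} (t : Term n Ξ (arrows Γ τ))
    (xs : Args n Ξ Γ) : (t.apps xs).subst f = (t.subst f).apps (Args.subst f xs) := by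
  induction xs with
  | nil => rfl
  | cons x xs ih => exact ih (t ⬝ x)

theorem Term.subst_cast (f : Subst n Ξ Θ) {σ τ : Ty} (h : σ = τ) (t : Term n Ξ σ) :
    (t.cast h).subst f = (t.subst f).cast h := by
  subst h; rfl

theorem Term.app_cast {σ τ τ' : Ty} (h : τ = τ') (t : Term n Ξ (σ ⇾ τ)) (x : Term n Ξ σ) :
    (t ⬝ x).cast h = t.cast (congrArg (σ ⇾ ·) h) ⬝ x := by
  subst h; rfl

theorem Term.apps_append {Γ Δ : List Ty} {τ : Ty} (t : Term n Ξ (arrows (Γ ++ Δ) τ))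
    (xs : Args n Ξ Γ) (ys : Args n Ξ Δ) :
    t.apps (xs.append ys) =
      Term.apps (Γ := Δ) (Term.apps (Γ := Γ) (t.cast (arrows_append Γ Δ τ)) xs) ys := by
  induction xs with
  | nil => rfl
  | cons x xs ih =>
    refine (ih (t ⬝ x)).trans ?_
    exact congrArg (fun u => Term.apps (Γ := Δ) (Term.apps u xs) ys) (Term.app_cast _ t x)

theorem PEq.apps {Γ : List Ty} {τ : Ty} {s t : Term n Ξ (arrows Γ τ)} (h : PEq s t)
    (xs : Args n Ξ Γ) : PEq (s.apps xs) (t.apps xs) := by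
  induction xs with
  | nil => exact h
  | cons x xs ih => exact ih (h.app (.refl x))

theorem PEq.apps_append_cons {Γ Δ : List Ty} {σ τ : Ty} (t : Term n Ξ (arrows (Γ ++ σ :: Δ) τ))
    (xs : Args n Ξ Γ) {x y : Term n Ξ σ} (h : PEq x y) (ys : Args n Ξ Δ) :
    PEq (t.apps (xs.append (.cons x ys))) (t.apps (xs.append (.cons y ys))) := by
  induction xs with
  | nil => exact ((refl t).app h).apps ys
  | cons z xs ih => exact ih (t ⬝ z)

/-- Extensionality for functions of several arguments. -/
theorem PEq.of_apps {Γ : List Ty} {τ : Ty} {s t : Term n Ξ (arrows Γ τ)}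
    (h : ∀ (Θ : List Ty) (f : Subst n Ξ Θ) (xs : Args n Θ Γ),
      PEq ((s.subst f).apps xs) ((t.subst f).apps xs)) : PEq s t := by
  induction Γ generalizing Ξ with
  | nil =>
    have h' : PEq (s.subst (idSubst n Ξ)) (t.subst (idSubst n Ξ)) := h Ξ (idSubst n Ξ) .nil
    rwa [Term.subst_idSubst, Term.subst_idSubst] at h'
  | cons σ Γ ih =>
    refine .ext (ih fun Θ f xs => ?_)
    have := h Θ (fun x => f x.succ) (.cons (f .zero) xs)
    have e : ∀ u : Term n Ξ (σ ⇾ arrows Γ τ), ((u.weaken ⬝ .var .zero).subst f).apps xs =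
        (u.subst (fun x => f x.succ) ⬝ f .zero).apps xs := fun u =>
      congrArg (fun w => (w ⬝ f .zero).apps xs) (u.subst_weaken f)
    exact (of_eq (e s)).trans (this.trans (of_eq (e t).symm))

end

/-! ### Equations for coderivations -/

namespace Coder

variable {n : ℕ}

theorem subst_apps {Γ : List Ty} {τ : Ty} {C : Coder n ⟨Γ, τ⟩} {Ξ Θ : List Ty} {t : Term n Ξ τ}
    {xs : Args n Ξ Γ} (h : PEq t (Term.apps (Γ := Γ) C.term xs)) (f : Subst n Ξ Θ) :
    PEq (t.subst f) (Term.apps (Γ := Γ) C.term (Args.subst f xs)) :=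
  (h.subst f).trans (.of_eq (Term.subst_apps (Γ := Γ) f C.term xs))

/-- Coderivations with the same tree have the same values, even if their antecedents are equal only
propositionally. -/
theorem apps_cast {Γ Γ' : List Ty} {τ : Ty} (h : Γ = Γ') {C : Coder n ⟨Γ, τ⟩}
    {C' : Coder n ⟨Γ', τ⟩} (hC : C'.tree = C.tree) {Ξ : List Ty} (xs : Args n Ξ Γ) :
    Term.apps (Γ := Γ') C'.term (xs.cast h) = Term.apps (Γ := Γ) C.term xs := by
  subst h
  rw [Coder.ext hC]
  rfl

/-- Coderivations can be moved along equalities of sequents without mention of transport, since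
they are determined by their trees. -/
theorem exists_cast {S S' : Sequent} (h : S = S') (C : Coder n S) :
    ∃ C' : Coder n S', C'.tree = C.tree := by
  subst h; exact ⟨C, rfl⟩

theorem exists_treesOf {Ps : List Sequent} {Us : List CoTree} (hlen : Us.length = Ps.length)
    (h : ∀ (i : ℕ) (hi : i < Us.length), ∃ D : Coder n Ps[i], D.tree = Us[i]) :
    ∃ Ds : HList (Coder n) Ps, treesOf Ds = Us := by
  induction Ps generalizing Us with
  | nil => exact ⟨.nil, (List.length_eq_zero_iff.1 hlen).symm⟩
  | cons P Ps ih =>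
    rcases Us with _ | ⟨U, Us⟩
    · simp at hlen
    · obtain ⟨D, rfl⟩ : ∃ D : Coder n P, D.tree = U := h 0 (by simp)
      obtain ⟨Ds, rfl⟩ := ih (Us := Us) (by simpa using hlen)
        fun i hi => h (i + 1) (by simpa using hi)
      exact ⟨.cons D Ds, rfl⟩

/-- A coderivation is the last step applied to its immediate sub-coderivations. The lemmas below
state what this means for each step, with the corresponding axiom. -/
theorem unfold {r : Step} (C : Coder n r.concl) {Us : List CoTree}
    (h : C.tree = CoTree.node r Us) (hlen : Us.length = r.premises.length) :
    ∃ Ds : HList (Coder n) r.premises, treesOf Ds = Us ∧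
      ∀ Ξ : List Ty, PEq (Ξ := Ξ) C.term ((stepT r).apps (termsOf Ds)) := by
  obtain ⟨Ds, hDs⟩ := exists_treesOf (n := n) hlen fun i hi => by
    have h1 : (C.tree [i]).map Step.concl = some (r.premises[i]) := by
      have := C.isCoderivation.correct [] i
      rw [h] at this ⊢
      simpa [CoTree.node, List.getElem?_eq_getElem (hlen ▸ hi)] using this
    obtain ⟨D, hD⟩ := C.exists_subtree h1
    refine ⟨D, hD.trans ?_⟩
    rw [h, CoTree.subtree_node (List.getElem?_eq_getElem hi)]
    rfl
  exact ⟨Ds, hDs, fun Ξ => .eqAxiom (.unfold r C Ds (by rw [hDs, h]))⟩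

theorem ex_apps {Γ : List Ty} {ρ σ : Ty} {Δ : List Ty} {τ : Ty} {C : Coder n ⟨Γ ++ ρ :: σ :: Δ, τ⟩}
    {U : CoTree} (h : C.tree = CoTree.node (.ex Γ ρ σ Δ τ) [U]) :
    ∃ D : Coder n ⟨Γ ++ σ :: ρ :: Δ, τ⟩, D.tree = U ∧ ∀ (Ξ : List Ty) (xs : Args n Ξ Γ)
      (x : Term n Ξ ρ) (y : Term n Ξ σ) (ys : Args n Ξ Δ),
      PEq (Term.apps (Γ := Γ ++ ρ :: σ :: Δ) C.term (xs.append (.cons x (.cons y ys))))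
        (Term.apps (Γ := Γ ++ σ :: ρ :: Δ) D.term (xs.append (.cons y (.cons x ys)))) := by
  obtain ⟨Ds, h1, h2⟩ := unfold (r := .ex Γ ρ σ Δ τ) C h rfl
  rcases Ds with _ | ⟨D, _ | _⟩
  refine ⟨D, by simpa [treesOf] using h1, fun Ξ xs x y ys => ?_⟩
  exact ((h2 Ξ).apps _).trans (.eqAxiom (.ex Γ ρ σ Δ τ D.term xs x y ys))

theorem wk_apps {Γ : List Ty} {σ τ : Ty} {C : Coder n ⟨Γ ++ [σ], τ⟩}
    {U : CoTree} (h : C.tree = CoTree.node (.wk Γ σ τ) [U]) :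
    ∃ D : Coder n ⟨Γ, τ⟩, D.tree = U ∧ ∀ (Ξ : List Ty) (xs : Args n Ξ Γ) (x : Term n Ξ σ),
      PEq (Term.apps (Γ := Γ ++ [σ]) C.term (xs.snoc x)) (Term.apps (Γ := Γ) D.term xs) := by
  obtain ⟨Ds, h1, h2⟩ := unfold (r := .wk Γ σ τ) C h rfl
  rcases Ds with _ | ⟨D, _ | _⟩
  refine ⟨D, by simpa [treesOf] using h1, fun Ξ xs x => ?_⟩
  exact ((h2 Ξ).apps _).trans (.eqAxiom (.wk Γ σ τ D.term xs x))

theorem cut_apps {Γ : List Ty} {σ τ : Ty} {C : Coder n ⟨Γ, τ⟩}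
    {U V : CoTree} (h : C.tree = CoTree.node (.cut Γ σ τ) [U, V]) :
    ∃ (D : Coder n ⟨Γ, σ⟩) (E : Coder n ⟨Γ ++ [σ], τ⟩), D.tree = U ∧ E.tree = V ∧
      ∀ (Ξ : List Ty) (xs : Args n Ξ Γ), PEq (Term.apps (Γ := Γ) C.term xs)
        (Term.apps (Γ := Γ ++ [σ]) E.term (xs.snoc (Term.apps (Γ := Γ) D.term xs))) := by
  obtain ⟨Ds, h1, h2⟩ := unfold (r := .cut Γ σ τ) C h rfl
  rcases Ds with _ | ⟨D, _ | ⟨E, _ | _⟩⟩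
  simp only [treesOf, List.cons.injEq] at h1
  refine ⟨D, E, h1.1, h1.2.1, fun Ξ xs => ?_⟩
  exact ((h2 Ξ).apps _).trans (.eqAxiom (.cut Γ σ τ D.term E.term xs))

theorem L_apps {Γ : List Ty} {ρ σ τ : Ty} {C : Coder n ⟨Γ ++ [ρ ⇾ σ], τ⟩}
    {U V : CoTree} (h : C.tree = CoTree.node (.L Γ ρ σ τ) [U, V]) :
    ∃ (D : Coder n ⟨Γ, ρ⟩) (E : Coder n ⟨Γ ++ [σ], τ⟩), D.tree = U ∧ E.tree = V ∧
      ∀ (Ξ : List Ty) (xs : Args n Ξ Γ) (y : Term n Ξ (ρ ⇾ σ)),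
        PEq (Term.apps (Γ := Γ ++ [ρ ⇾ σ]) C.term (xs.snoc y))
          (Term.apps (Γ := Γ ++ [σ]) E.term (xs.snoc (y ⬝ Term.apps (Γ := Γ) D.term xs))) := by
  obtain ⟨Ds, h1, h2⟩ := unfold (r := .L Γ ρ σ τ) C h rfl
  rcases Ds with _ | ⟨D, _ | ⟨E, _ | _⟩⟩
  simp only [treesOf, List.cons.injEq] at h1
  refine ⟨D, E, h1.1, h1.2.1, fun Ξ xs y => ?_⟩
  exact ((h2 Ξ).apps _).trans (.eqAxiom (.L Γ ρ σ τ D.term E.term xs y))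

theorem R_apps {Γ : List Ty} {σ τ : Ty} {C : Coder n ⟨Γ, σ ⇾ τ⟩}
    {U : CoTree} (h : C.tree = CoTree.node (.R Γ σ τ) [U]) :
    ∃ D : Coder n ⟨Γ ++ [σ], τ⟩, D.tree = U ∧
      ∀ (Ξ : List Ty) (xs : Args n Ξ Γ) (x : Term n Ξ σ),
        PEq (Term.apps (Γ := Γ) (τ := σ ⇾ τ) C.term xs ⬝ x)
          (Term.apps (Γ := Γ ++ [σ]) D.term (xs.snoc x)) := by
  obtain ⟨Ds, h1, h2⟩ := unfold (r := .R Γ σ τ) C h rfl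
  rcases Ds with _ | ⟨D, _ | _⟩
  refine ⟨D, by simpa [treesOf] using h1, fun Ξ xs x => ?_⟩
  exact (((h2 Ξ).apps (Γ := Γ) (τ := σ ⇾ τ) xs).app (.refl x)).trans
    (.eqAxiom (.R Γ σ τ D.term xs x))

theorem id_apps {σ : Ty} {C : Coder n ⟨[σ], σ⟩} (h : C.tree = CoTree.node (.id σ) [])
    (Ξ : List Ty) : PEq (Ξ := Ξ) C.term (stepT (.id σ)) := by
  obtain ⟨Ds, h1, h2⟩ := unfold (r := .id σ) C h rfl
  rcases Ds with _ | _
  exact h2 Ξ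

theorem zero_apps {C : Coder n ⟨[], .N⟩} (h : C.tree = CoTree.node .zero [])
    (Ξ : List Ty) : PEq (Ξ := Ξ) C.term zeroT := by
  obtain ⟨Ds, h1, h2⟩ := unfold (r := .zero) C h rfl
  rcases Ds with _ | _
  exact h2 Ξ

theorem succ_apps {C : Coder n ⟨[.N], .N⟩} (h : C.tree = CoTree.node .succ [])
    (Ξ : List Ty) : PEq (Ξ := Ξ) C.term (stepT .succ) := by
  obtain ⟨Ds, h1, h2⟩ := unfold (r := .succ) C h rfl
  rcases Ds with _ | _
  exact h2 Ξ

theorem cond_apps {Γ : List Ty} {τ : Ty} {C : Coder n ⟨Γ ++ [.N], τ⟩}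
    {U V : CoTree} (h : C.tree = CoTree.node (.cond Γ τ) [U, V]) :
    ∃ (D : Coder n ⟨Γ, τ⟩) (E : Coder n ⟨Γ ++ [.N], τ⟩), D.tree = U ∧ E.tree = V ∧
      ∀ (Ξ : List Ty) (xs : Args n Ξ Γ),
        PEq (Term.apps (Γ := Γ ++ [.N]) C.term (xs.snoc zeroT)) (Term.apps (Γ := Γ) D.term xs) ∧
        ∀ y, PEq (Term.apps (Γ := Γ ++ [.N]) C.term (xs.snoc (succT y)))
          (Term.apps (Γ := Γ ++ [.N]) E.term (xs.snoc y)) := by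
  obtain ⟨Ds, h1, h2⟩ := unfold (r := .cond Γ τ) C h rfl
  rcases Ds with _ | ⟨D, _ | ⟨E, _ | _⟩⟩
  simp only [treesOf, List.cons.injEq] at h1
  refine ⟨D, E, h1.1, h1.2.1, fun Ξ xs => ⟨?_, fun y => ?_⟩⟩
  · exact ((h2 Ξ).apps _).trans (.eqAxiom (.cond_zero Γ τ D.term E.term xs))
  · exact ((h2 Ξ).apps _).trans (.eqAxiom (.cond_succ Γ τ D.term E.term xs y))

end Coder

/-! ### Moving an antecedent type across a block -/

/-- From `Γ, ρs, δ ⇒ τ` to `Γ, δ, ρs ⇒ τ` by exchanges. -/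
def CoTree.moveRight (Γ : List Ty) (δ : Ty) : List Ty → Ty → CoTree → CoTree
  | [], _, T => T
  | ρ :: ρs, τ, T => node (.ex Γ δ ρ ρs τ) [moveRight (Γ ++ [ρ]) δ ρs τ T]

/-- From `Γ, δ, ρs ⇒ τ` to `Γ, ρs, δ ⇒ τ` by exchanges. -/
def CoTree.moveLeft (Γ : List Ty) (δ : Ty) : List Ty → Ty → CoTree → CoTree
  | [], _, T => T
  | ρ :: ρs, τ, T => moveLeft (Γ ++ [ρ]) δ ρs τ (node (.ex Γ ρ δ ρs τ) [T])

theorem CoTree.Agree.moveRight {m : ℕ} {T U : CoTree} (h : Agree m T U) (Γ : List Ty) (δ : Ty)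
    (ρs : List Ty) (τ : Ty) :
    Agree m (CoTree.moveRight Γ δ ρs τ T) (CoTree.moveRight Γ δ ρs τ U) := by
  induction ρs generalizing Γ with
  | nil => exact h
  | cons ρ ρs ih => exact ((ih (Γ ++ [ρ])).node₁ _).mono (Nat.le_succ m)

theorem CoTree.Agree.moveLeft {m : ℕ} {T U : CoTree} (h : Agree m T U) (Γ : List Ty) (δ : Ty)
    (ρs : List Ty) (τ : Ty) :
    Agree m (CoTree.moveLeft Γ δ ρs τ T) (CoTree.moveLeft Γ δ ρs τ U) := by
  induction ρs generalizing Γ T U with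
  | nil => exact h
  | cons ρ ρs ih => exact ih ((h.node₁ _).mono (Nat.le_succ m)) (Γ ++ [ρ])

namespace OpenDer

variable {n : ℕ} {O : List Oracle} {g g' : ℕ → ℕ} {v : ℕ → Prop} {u : Prop} {T : CoTree}

theorem moveRight {Γ : List Ty} {δ : Ty} {ρs : List Ty} {τ : Ty}
    (hlev : (⟨Γ ++ δ :: ρs, τ⟩ : Sequent).LevLE n)
    (h : OpenDer n O ⟨Γ ++ (ρs ++ [δ]), τ⟩ g' v u T)
    (hg : ∀ E ∈ O, ∀ p < E.len, (g p < Γ.length ∧ g' p = g p) ∨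
      (g p = Γ.length ∧ g' p = Γ.length + ρs.length)) :
    OpenDer n O ⟨Γ ++ δ :: ρs, τ⟩ g v u (CoTree.moveRight Γ δ ρs τ T) := by
  induction ρs generalizing Γ g with
  | nil =>
    refine h.weaken (fun _ h => h) (fun E hE p hp => ?_) (fun _ h => h) id
    have := hg E hE p hp
    simp only [List.length_nil] at this
    omega
  | cons ρ ρs ih =>
    have hlev' : (⟨(Γ ++ [ρ]) ++ δ :: ρs, τ⟩ : Sequent).LevLE n := by
      refine ⟨fun σ hσ => hlev.1 σ ?_, hlev.2⟩
      simp only [List.mem_append, List.mem_cons] at hσ ⊢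
      tauto
    have h1 := ih (Γ := Γ ++ [ρ]) (g := fun p => if g p = Γ.length then Γ.length + 1 else g p)
      hlev' (by simpa using h) (fun E hE p hp => by
        have := hg E hE p hp
        simp only [List.length_append, List.length_cons, List.length_nil] at this ⊢
        split_ifs <;> omega)
    rw [List.append_assoc] at h1
    refine node₁ (r := .ex Γ δ ρ ρs τ) rfl hlev h1 fun E hE p hp => ⟨⟨rfl, ?_, ?_⟩, Or.inl⟩
    · have := hg E hE p hp
      omega
    · rcases hg E hE p hp with h | h
      · rw [if_neg (by omega), Equiv.swap_apply_of_ne_of_ne (by omega) (by omega)]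
      · rw [if_pos h.1, h.1, Equiv.swap_apply_left]

theorem moveLeft {Γ : List Ty} {δ : Ty} {ρs : List Ty} {τ : Ty}
    (hlev : (⟨Γ ++ (ρs ++ [δ]), τ⟩ : Sequent).LevLE n)
    (h : OpenDer n O ⟨Γ ++ δ :: ρs, τ⟩ g' v u T)
    (hg : ∀ E ∈ O, ∀ p < E.len, (g p < Γ.length ∧ g' p = g p) ∨
      (g p = Γ.length + ρs.length ∧ g' p = Γ.length)) :
    OpenDer n O ⟨Γ ++ (ρs ++ [δ]), τ⟩ g v u (CoTree.moveLeft Γ δ ρs τ T) := by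
  induction ρs generalizing Γ g' T with
  | nil =>
    refine h.weaken (fun _ h => h) (fun E hE p hp => ?_) (fun _ h => h) id
    have := hg E hE p hp
    simp only [List.length_nil] at this
    omega
  | cons ρ ρs ih =>
    have hlev' : (⟨Γ ++ ρ :: δ :: ρs, τ⟩ : Sequent).LevLE n := by
      refine ⟨fun σ hσ => hlev.1 σ ?_, hlev.2⟩
      simp only [List.mem_append, List.mem_cons] at hσ ⊢
      tauto
    have h1 : OpenDer n O ⟨Γ ++ ρ :: δ :: ρs, τ⟩
        (fun p => if g p < Γ.length then g p else Γ.length + 1) v u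
        (CoTree.node (.ex Γ ρ δ ρs τ) [T]) :=
      node₁ (r := .ex Γ ρ δ ρs τ) rfl hlev' h fun E hE p hp => ⟨⟨rfl, by
        have := hg E hE p hp
        split_ifs <;> omega, by
        rcases hg E hE p hp with h | h
        · rw [if_pos h.1, Equiv.swap_apply_of_ne_of_ne (by omega) (by omega), h.2]
        · rw [if_neg (by omega), Equiv.swap_apply_right, h.2]⟩, Or.inl⟩
    have h2 := ih (Γ := Γ ++ [ρ]) (by simpa using hlev) (by simpa using h1)
      (fun E hE p hp => by
        have := hg E hE p hp
        simp only [List.length_append, List.length_cons, List.length_nil] at this ⊢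
        split_ifs <;> omega)
    rw [List.append_assoc] at h2
    exact h2

end OpenDer

namespace Coder

variable {n : ℕ}

theorem moveRight_apps {Γ : List Ty} {δ : Ty} {ρs : List Ty} {τ : Ty}
    {C : Coder n ⟨Γ ++ δ :: ρs, τ⟩} {U : CoTree} (h : C.tree = CoTree.moveRight Γ δ ρs τ U) :
    ∃ D : Coder n ⟨Γ ++ (ρs ++ [δ]), τ⟩, D.tree = U ∧ ∀ (Ξ : List Ty) (xs : Args n Ξ Γ)
      (x : Term n Ξ δ) (ys : Args n Ξ ρs),
      PEq (Term.apps (Γ := Γ ++ δ :: ρs) C.term (xs.append (.cons x ys)))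
        (Term.apps (Γ := Γ ++ (ρs ++ [δ])) D.term (xs.append (ys.snoc x))) := by
  induction ρs generalizing Γ with
  | nil =>
    refine ⟨C, h, fun Ξ xs x ys => ?_⟩
    rcases ys with _ | _
    exact .refl _
  | cons ρ ρs ih =>
    obtain ⟨D₁, h₁, e₁⟩ := ex_apps h
    obtain ⟨D₂, h₂⟩ := D₁.exists_cast (S' := ⟨(Γ ++ [ρ]) ++ δ :: ρs, τ⟩) (by simp)
    obtain ⟨D₃, h₃, e₃⟩ := ih (h₂.trans h₁)
    obtain ⟨D₄, h₄⟩ := D₃.exists_cast (S' := ⟨Γ ++ (ρ :: ρs ++ [δ]), τ⟩) (by simp)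
    refine ⟨D₄, h₄.trans h₃, fun Ξ xs x ys => ?_⟩
    rcases ys with _ | ⟨y, ys⟩
    refine (e₁ Ξ xs x y ys).trans ?_
    have e := e₃ Ξ (xs.snoc y) x ys
    rw [HList.snoc_append, apps_cast _ h₂, HList.snoc_append, apps_cast _ h₄.symm] at e
    exact e

theorem moveLeft_apps {Γ : List Ty} {δ : Ty} {ρs : List Ty} {τ : Ty}
    {C : Coder n ⟨Γ ++ (ρs ++ [δ]), τ⟩} {U : CoTree} (h : C.tree = CoTree.moveLeft Γ δ ρs τ U) :
    ∃ D : Coder n ⟨Γ ++ δ :: ρs, τ⟩, D.tree = U ∧ ∀ (Ξ : List Ty) (xs : Args n Ξ Γ)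
      (x : Term n Ξ δ) (ys : Args n Ξ ρs),
      PEq (Term.apps (Γ := Γ ++ (ρs ++ [δ])) C.term (xs.append (ys.snoc x)))
        (Term.apps (Γ := Γ ++ δ :: ρs) D.term (xs.append (.cons x ys))) := by
  induction ρs generalizing Γ U with
  | nil =>
    refine ⟨C, h, fun Ξ xs x ys => ?_⟩
    rcases ys with _ | _
    exact .refl _
  | cons ρ ρs ih =>
    obtain ⟨D₁, h₁⟩ := C.exists_cast (S' := ⟨(Γ ++ [ρ]) ++ (ρs ++ [δ]), τ⟩) (by simp)
    obtain ⟨D₂, h₂, e₂⟩ := ih (h₁.trans h)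
    obtain ⟨D₃, h₃⟩ := D₂.exists_cast (S' := ⟨Γ ++ ρ :: δ :: ρs, τ⟩) (by simp)
    obtain ⟨D₄, h₄, e₄⟩ := ex_apps (h₃.trans h₂)
    refine ⟨D₄, h₄, fun Ξ xs x ys => ?_⟩
    rcases ys with _ | ⟨y, ys⟩
    have e := e₂ Ξ (xs.snoc y) x ys
    rw [HList.snoc_append, apps_cast _ h₁, HList.snoc_append, apps_cast _ h₃.symm] at e
    exact e.trans (e₄ Ξ xs y x ys)

end Coder

variable {n : ℕ}

/-! ### Worlds -/

/-- A world is a sequence of typed variables and oracles. An oracle with the types `ρs` stands for a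
coderivation of `Γ, ρs ⇒ N`, where `Γ` lists the types of the variables that precede it. -/
inductive World (n : ℕ) : Type
  | nil : World n
  | var (W : World n) (σ : Ty) (h : σ.lev ≤ n) : World n
  | ora (W : World n) (ρs : List Ty) (h : ∀ ρ ∈ ρs, ρ.lev ≤ n) : World n

namespace World

/-- The variables of a world as a context of terms, the last one first. -/
def ctx : World n → List Ty
  | nil => []
  | var W σ _ => σ :: W.ctx
  | ora W _ _ => W.ctx

/-- The variables of a world as an antecedent, the last one last. -/
def ant : World n → List Ty
  | nil => []
  | var W σ _ => W.ant ++ [σ]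
  | ora W _ _ => W.ant

/-- The variables of a world as terms, in the order of the antecedent. -/
def vars : (W : World n) → Args n W.ctx W.ant
  | nil => .nil
  | var W _ _ => (Args.subst (fun x => .var x.succ) W.vars).snoc (.var .zero)
  | ora W _ _ => W.vars

/-- Assignments of coderivations to the oracles of a world. -/
def Env : World n → Type
  | nil => Unit
  | var W _ _ => W.Env
  | ora W ρs _ => W.Env × Coder n ⟨W.ant ++ ρs, .N⟩

/-- Assignments of arbitrary trees to the oracles of a world. -/
def TreeEnv : World n → Type
  | nil => Unit
  | var W _ _ => W.TreeEnv
  | ora W _ _ => W.TreeEnv × CoTree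

/-- The trees underlying an assignment of coderivations. -/
def trees : (W : World n) → W.Env → W.TreeEnv
  | nil, _ => ()
  | var W _ _, e => W.trees e
  | ora W _ _, e => (W.trees e.1, e.2.tree)

/-- Agreement of assignments of trees at all addresses of length less than `m`. -/
def Agree (m : ℕ) : (W : World n) → W.TreeEnv → W.TreeEnv → Prop
  | nil, _, _ => True
  | var W _ _, e, e' => Agree m W e e'
  | ora W _ _, e, e' => Agree m W e.1 e'.1 ∧ CoTree.Agree m e.2 e'.2

/-- The oracles of a world under an assignment of trees. Threads are required for the positions of
all variables that precede the oracle. -/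
def oracles : (W : World n) → W.TreeEnv → List Oracle
  | nil, _ => []
  | var W _ _, e => W.oracles e
  | ora W ρs _, e => ⟨e.2, ⟨W.ant ++ ρs, .N⟩, W.ant.length⟩ :: W.oracles e.1

theorem subst_vars_var (W : World n) {σ : Ty} (hσ : σ.lev ≤ n) {Θ : List Ty}
    (f : Subst n (σ :: W.ctx) Θ) :
    Args.subst (Ξ := (W.var σ hσ).ctx) f (W.var σ hσ).vars =
      (Args.subst (fun x => f x.succ) W.vars).snoc (f .zero) :=
  (Args.subst_snoc f _ _).trans
    (congrArg (fun xs => HList.snoc xs (f .zero)) (Args.subst_subst_succ f W.vars))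

theorem lev_of_mem_ant {W : World n} {σ : Ty} (h : σ ∈ W.ant) : σ.lev ≤ n := by
  induction W with
  | nil => simp [ant] at h
  | var W τ hτ ih =>
    rcases List.mem_append.1 h with h | h
    · exact ih h
    · rw [List.mem_singleton.1 h]; exact hτ
  | ora W ρs hρs ih => exact ih h

theorem levLE_append {W : World n} {ρs : List Ty} {τ : Ty} (hρs : ∀ ρ ∈ ρs, ρ.lev ≤ n)
    (hτ : τ.lev ≤ n) : (⟨W.ant ++ ρs, τ⟩ : Sequent).LevLE n :=
  ⟨fun σ hσ => (List.mem_append.1 hσ).elim lev_of_mem_ant (hρs σ), hτ⟩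

theorem len_le_of_mem_oracles {W : World n} {e : W.TreeEnv} {E : Oracle} (h : E ∈ W.oracles e) :
    E.len ≤ W.ant.length := by
  induction W with
  | nil => simp [oracles] at h
  | var W τ hτ ih => exact (ih h).trans (by simp [ant])
  | ora W ρs hρs ih =>
    rcases List.mem_cons.1 h with rfl | h
    · exact le_rfl
    · exact ih h

theorem openDer_of_mem_oracles {W : World n} {e : W.Env} {E : Oracle}
    (h : E ∈ W.oracles (W.trees e)) :
    OpenDer n [] E.seq (fun p => p) (fun _ => False) False E.tree := by
  induction W with
  | nil => simp [oracles] at h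
  | var W τ hτ ih => exact ih h
  | ora W ρs hρs ih =>
    rcases List.mem_cons.1 h with rfl | h
    · exact e.2.openDer
    · exact ih h

theorem Agree.mono {m k : ℕ} (hk : k ≤ m) {W : World n} {e e' : W.TreeEnv}
    (h : W.Agree m e e') : W.Agree k e e' := by
  induction W with
  | nil => trivial
  | var W τ hτ ih => exact ih h
  | ora W ρs hρs ih => exact ⟨ih h.1, h.2.mono hk⟩

theorem Agree.refl (m : ℕ) {W : World n} (e : W.TreeEnv) : W.Agree m e e := by
  induction W with
  | nil => trivial
  | var W τ hτ ih => exact ih e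
  | ora W ρs hρs ih => exact ⟨ih e.1, CoTree.Agree.refl _ _⟩

end World

/-! ### Uniform derivations -/

/-- A derivation of `S` from the oracles of `W`, given as a function of the trees assigned to the
oracles. By `agree`, the function does not look deeper into the oracles than the address at which
it is evaluated, which makes fixed points available. By `openDer`, every variable of `W` can be
followed from the root to each oracle that it precedes. -/
structure UniformDer (W : World n) (S : Sequent) (D : W.TreeEnv → CoTree) : Prop where
  agree : ∀ m e e', W.Agree m e e' → CoTree.Agree m (D e) (D e')
  openDer : ∀ e, OpenDer n (W.oracles e) S (fun p => p) (fun _ => False) False (D e)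

namespace UniformDer

variable {W : World n} {S : Sequent} {D E : W.TreeEnv → CoTree}

/-- If coderivations are plugged in for the oracles, the result is a coderivation. -/
theorem exists_coder (h : UniformDer W S D) (e : W.Env) :
    ∃ C : Coder n S, C.tree = D (W.trees e) :=
  ((h.openDer _).close fun _ hE => World.openDer_of_mem_oracles hE).exists_coder

theorem wk {Γ : List Ty} {σ τ : Ty} (hΓ : W.ant.length ≤ Γ.length)
    (hlev : (⟨Γ ++ [σ], τ⟩ : Sequent).LevLE n) (h : UniformDer W ⟨Γ, τ⟩ D) :
    UniformDer W ⟨Γ ++ [σ], τ⟩ fun e => .node (.wk Γ σ τ) [D e] where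
  agree m e e' he := ((h.agree m e e' he).node₁ _).mono (Nat.le_succ m)
  openDer e := OpenDer.node₁ (r := .wk Γ σ τ) rfl hlev (h.openDer e) fun E hE p hp => by
    have := World.len_le_of_mem_oracles hE
    exact ⟨⟨rfl, by omega, rfl⟩, False.elim⟩

theorem cut {Γ : List Ty} {σ τ : Ty} (hΓ : W.ant.length ≤ Γ.length)
    (hlev : (⟨Γ, τ⟩ : Sequent).LevLE n) (h : UniformDer W ⟨Γ, σ⟩ D)
    (h' : UniformDer W ⟨Γ ++ [σ], τ⟩ E) :
    UniformDer W ⟨Γ, τ⟩ fun e => .node (.cut Γ σ τ) [D e, E e] where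
  agree m e e' he :=
    ((h.agree m e e' he).node₂ (h'.agree m e e' he) _).mono (Nat.le_succ m)
  openDer e := OpenDer.node₂ (r := .cut Γ σ τ) rfl hlev (fun _ h => h) (fun _ h => h)
    (h.openDer e) (h'.openDer e)
    (fun E hE p hp => by
      have := World.len_le_of_mem_oracles hE
      exact ⟨⟨.inl rfl, by omega, rfl⟩, False.elim⟩)
    (fun E hE p hp => by
      have := World.len_le_of_mem_oracles hE
      exact ⟨⟨.inr rfl, by omega, rfl⟩, False.elim⟩)

theorem L {Γ : List Ty} {ρ σ τ : Ty} (hΓ : W.ant.length ≤ Γ.length)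
    (hlev : (⟨Γ ++ [ρ ⇾ σ], τ⟩ : Sequent).LevLE n) (h : UniformDer W ⟨Γ, ρ⟩ D)
    (h' : UniformDer W ⟨Γ ++ [σ], τ⟩ E) :
    UniformDer W ⟨Γ ++ [ρ ⇾ σ], τ⟩ fun e => .node (.L Γ ρ σ τ) [D e, E e] where
  agree m e e' he :=
    ((h.agree m e e' he).node₂ (h'.agree m e e' he) _).mono (Nat.le_succ m)
  openDer e := OpenDer.node₂ (r := .L Γ ρ σ τ) rfl hlev (fun _ h => h) (fun _ h => h)
    (h.openDer e) (h'.openDer e)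
    (fun E hE p hp => by
      have := World.len_le_of_mem_oracles hE
      exact ⟨⟨.inl rfl, by omega, rfl⟩, False.elim⟩)
    (fun E hE p hp => by
      have := World.len_le_of_mem_oracles hE
      exact ⟨⟨.inr rfl, by omega, rfl⟩, False.elim⟩)

theorem R {Γ : List Ty} {σ τ : Ty} (hΓ : W.ant.length ≤ Γ.length)
    (hlev : (⟨Γ, σ ⇾ τ⟩ : Sequent).LevLE n) (h : UniformDer W ⟨Γ ++ [σ], τ⟩ D) :
    UniformDer W ⟨Γ, σ ⇾ τ⟩ fun e => .node (.R Γ σ τ) [D e] where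
  agree m e e' he := ((h.agree m e e' he).node₁ _).mono (Nat.le_succ m)
  openDer e := OpenDer.node₁ (r := .R Γ σ τ) rfl hlev (h.openDer e) fun E hE p hp => by
    have := World.len_le_of_mem_oracles hE
    exact ⟨⟨rfl, by omega, rfl⟩, False.elim⟩

theorem moveRight {Γ : List Ty} {δ : Ty} {ρs : List Ty} {τ : Ty} (hΓ : W.ant.length ≤ Γ.length)
    (hlev : (⟨Γ ++ δ :: ρs, τ⟩ : Sequent).LevLE n) (h : UniformDer W ⟨Γ ++ (ρs ++ [δ]), τ⟩ D) :
    UniformDer W ⟨Γ ++ δ :: ρs, τ⟩ fun e => .moveRight Γ δ ρs τ (D e) where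
  agree m e e' he := (h.agree m e e' he).moveRight _ _ _ _
  openDer e := (h.openDer e).moveRight hlev fun E hE p hp => by
    have := World.len_le_of_mem_oracles hE
    exact .inl ⟨by omega, rfl⟩

theorem moveLeft {Γ : List Ty} {δ : Ty} {ρs : List Ty} {τ : Ty} (hΓ : W.ant.length ≤ Γ.length)
    (hlev : (⟨Γ ++ (ρs ++ [δ]), τ⟩ : Sequent).LevLE n) (h : UniformDer W ⟨Γ ++ δ :: ρs, τ⟩ D) :
    UniformDer W ⟨Γ ++ (ρs ++ [δ]), τ⟩ fun e => .moveLeft Γ δ ρs τ (D e) where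
  agree m e e' he := (h.agree m e e' he).moveLeft _ _ _ _
  openDer e := (h.openDer e).moveLeft hlev fun E hE p hp => by
    have := World.len_le_of_mem_oracles hE
    exact .inl ⟨by omega, rfl⟩

/-- Weakening by a list of types. -/
theorem exists_wk_append {Γ : List Ty} (ρs : List Ty) {τ : Ty} (hΓ : W.ant.length ≤ Γ.length)
    (hlev : (⟨Γ ++ ρs, τ⟩ : Sequent).LevLE n) (h : UniformDer W ⟨Γ, τ⟩ D) :
    ∃ D', UniformDer W ⟨Γ ++ ρs, τ⟩ D' ∧ ∀ e (C' : Coder n ⟨Γ ++ ρs, τ⟩), C'.tree = D' e →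
      ∃ C : Coder n ⟨Γ, τ⟩, C.tree = D e ∧ ∀ (Ξ : List Ty) (xs : Args n Ξ Γ) (ys : Args n Ξ ρs),
        PEq (Term.apps (Γ := Γ ++ ρs) C'.term (xs.append ys)) (Term.apps (Γ := Γ) C.term xs) := by
  induction ρs using List.reverseRecOn with
  | nil =>
    refine ⟨D, by simpa using h, fun e C' hC' => ?_⟩
    obtain ⟨C, hC⟩ := C'.exists_cast (S' := ⟨Γ, τ⟩) (by simp)
    refine ⟨C, hC.trans hC', fun Ξ xs ys => ?_⟩
    rcases ys with _ | _
    rw [← Coder.apps_cast (List.append_nil Γ) hC]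
    rw [HList.append_nil]
    exact .refl _
  | append_singleton ρs ρ ih =>
    have hlev' : (⟨(Γ ++ ρs) ++ [ρ], τ⟩ : Sequent).LevLE n := by simpa using hlev
    obtain ⟨D', hD', hC'⟩ := ih ⟨fun σ hσ => hlev'.1 σ (List.mem_append_left _ hσ), hlev'.2⟩
    refine ⟨_, by simpa using hD'.wk (by simp; omega) hlev', fun e C₁ h₁ => ?_⟩
    obtain ⟨C₂, h₂⟩ := C₁.exists_cast (S' := ⟨(Γ ++ ρs) ++ [ρ], τ⟩) (by simp)
    obtain ⟨C₃, h₃, e₃⟩ := Coder.wk_apps (h₂.trans h₁)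
    obtain ⟨C, hC, eC⟩ := hC' e C₃ h₃
    refine ⟨C, hC, fun Ξ xs ys => ?_⟩
    obtain ⟨ys, y, rfl⟩ := ys.exists_append
    rcases y with _ | ⟨y, _ | _⟩
    have e := e₃ Ξ (xs.append ys) y
    rw [HList.append_snoc, Coder.apps_cast _ h₂] at e
    exact e.trans (eC Ξ xs ys)

end UniformDer

/-! ### Derivable terms -/

/-- A family of terms in the variables of `W` that depends on the coderivations assigned to the
oracles of `W`. -/
abbrev Elem (W : World n) (σ : Ty) : Type := W.Env → Term n W.ctx σ

/-- The term `t` is provably equal to a derivation, uniformly in the oracles. -/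
def Derives (W : World n) (τ : Ty) (t : Elem W τ) : Prop :=
  ∃ D, UniformDer W ⟨W.ant, τ⟩ D ∧ ∀ e (C : Coder n ⟨W.ant, τ⟩), C.tree = D (W.trees e) →
    PEq (t e) (Term.apps (Γ := W.ant) C.term W.vars)

/-- The term `t` is, as a function of arguments of types `ρs`, provably equal to a derivation with
the additional antecedent types `ρs`, uniformly in the oracles. -/
def DerivesFun (W : World n) (ρs : List Ty) (τ : Ty) (t : Elem W (arrows ρs τ)) : Prop :=
  ∃ D, UniformDer W ⟨W.ant ++ ρs, τ⟩ D ∧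
    ∀ e (C : Coder n ⟨W.ant ++ ρs, τ⟩), C.tree = D (W.trees e) →
      ∀ (Θ : List Ty) (f : Subst n W.ctx Θ) (ys : Args n Θ ρs), PEq (((t e).subst f).apps ys)
        (Term.apps (Γ := W.ant ++ ρs) C.term ((Args.subst f W.vars).append ys))

theorem Derives.congr {W : World n} {τ : Ty} {t t' : Elem W τ} (h : Derives W τ t)
    (ht : ∀ e, PEq (t e) (t' e)) : Derives W τ t' := by
  obtain ⟨D, hD, hC⟩ := h
  exact ⟨D, hD, fun e C he => (ht e).symm.trans (hC e C he)⟩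

theorem derivesFun_nil_iff {W : World n} {τ : Ty} {t : Elem W τ} :
    DerivesFun W [] τ t ↔ Derives W τ t := by
  constructor
  · rintro ⟨D, hD, hC⟩
    refine ⟨D, by simpa using hD, fun e C he => ?_⟩
    obtain ⟨C', hC'⟩ := C.exists_cast (S' := ⟨W.ant ++ [], τ⟩) (by simp)
    have h := hC e C' (hC'.trans he) _ (idSubst n _) .nil
    have h1 : (t e).subst (idSubst n _) = t e := Term.subst_idSubst _
    rw [← Coder.apps_cast (List.append_nil _) hC'.symm, HList.append_nil,
      Args.subst_idSubst] at h
    exact (PEq.of_eq h1).symm.trans h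
  · rintro ⟨D, hD, hC⟩
    refine ⟨D, by simpa using hD, fun e C he Θ f ys => ?_⟩
    obtain ⟨C', hC'⟩ := C.exists_cast (S' := ⟨W.ant, τ⟩) (by simp)
    have h := Coder.subst_apps (hC e C' (hC'.trans he)) f
    rcases ys with _ | _
    rw [← Coder.apps_cast (List.append_nil _) hC', HList.append_nil]
    exact h

/-- The last variable of a world may instead be the first argument of a function. -/
theorem DerivesFun.cons_of_var {W : World n} {σ : Ty} {hσ : σ.lev ≤ n} {ρs : List Ty} {τ : Ty}
    {t : Elem W (σ ⇾ arrows ρs τ)}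
    (h : DerivesFun (W.var σ hσ) ρs τ fun e => (t e).weaken ⬝ .var .zero) :
    DerivesFun W (σ :: ρs) τ t := by
  obtain ⟨D, hD, hC⟩ := h
  have e0 : (W.var σ hσ).ant ++ ρs = W.ant ++ σ :: ρs := by simp [World.ant]
  refine ⟨D, ⟨hD.agree, fun e => e0 ▸ hD.openDer e⟩, fun e C he Θ f ys => ?_⟩
  rcases ys with _ | ⟨y, ys⟩
  obtain ⟨C', hC'⟩ := C.exists_cast (S' := ⟨(W.var σ hσ).ant ++ ρs, τ⟩) (by rw [e0])
  have h := hC e C' (hC'.trans he) Θ (f.extend y) ys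
  rw [World.subst_vars_var] at h
  have h2 : ((Args.subst f W.vars).snoc y).append ys = _ := HList.snoc_append _ y ys
  have h3 := Coder.apps_cast (List.append_cons _ _ _) hC'
    ((Args.subst f W.vars).append (.cons y ys))
  rw [← h2] at h3
  rw [← h3]
  refine (PEq.of_eq ?_).trans h
  exact congrArg (fun u => (u ⬝ y).apps ys) ((t e).subst_weaken_extend f y).symm

/-- Derivability is preserved by a new variable, which is inserted before the arguments. -/
theorem DerivesFun.var {W : World n} {ρs : List Ty} {τ : Ty} {t : Elem W (arrows ρs τ)}
    (h : DerivesFun W ρs τ t) {δ : Ty} (hδ : δ.lev ≤ n) (hρs : ∀ ρ ∈ ρs, ρ.lev ≤ n)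
    (hτ : τ.lev ≤ n) : DerivesFun (W.var δ hδ) ρs τ fun e => (t e).weaken := by
  obtain ⟨D, hD, hC⟩ := h
  have e0 : (W.var δ hδ).ant ++ ρs = W.ant ++ δ :: ρs := by simp [World.ant]
  have hl : ∀ σ ∈ δ :: ρs, σ.lev ≤ n := by simpa using ⟨hδ, hρs⟩
  have h1 : UniformDer W _ _ := hD.wk (σ := δ) (by simp)
    (by
      rw [List.append_assoc]
      exact World.levLE_append (by simpa [or_imp, forall_and] using ⟨hρs, hδ⟩) hτ)
  rw [List.append_assoc] at h1
  have h2 := h1.moveRight le_rfl (World.levLE_append hl hτ)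
  refine ⟨_, ⟨h2.agree, fun e => e0 ▸ h2.openDer e⟩, fun e C he Θ f ys => ?_⟩
  obtain ⟨C₁, h₁⟩ := C.exists_cast (S' := ⟨W.ant ++ δ :: ρs, τ⟩) (by rw [e0])
  obtain ⟨C₂, h₂, e₂⟩ := Coder.moveRight_apps (h₁.trans he)
  obtain ⟨C₃, h₃⟩ := C₂.exists_cast (S' := ⟨(W.ant ++ ρs) ++ [δ], τ⟩) (by simp)
  obtain ⟨C₄, h₄, e₄⟩ := Coder.wk_apps (h₃.trans h₂)
  have h5 := hC e C₄ h₄ Θ (fun x => f x.succ) ys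
  refine PEq.trans ?_ (.of_eq (congrArg (fun xs => Term.apps (Γ := (W.var δ hδ).ant ++ ρs) C.term
    (HList.append xs ys)) (W.subst_vars_var hδ f)).symm)
  have h7 := HList.snoc_append (Args.subst (fun x => f x.succ) W.vars) (f .zero) ys
  have h8 := Coder.apps_cast (List.append_cons _ _ _) h₁.symm
    ((Args.subst (fun x => f x.succ) W.vars).append (.cons (f .zero) ys))
  rw [← h7] at h8
  refine PEq.trans ?_ (.of_eq h8.symm)
  have h6 := e₄ Θ ((Args.subst (fun x => f x.succ) W.vars).append ys) (f .zero)
  rw [HList.append_snoc, Coder.apps_cast _ h₃] at h6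
  refine (PEq.of_eq (congrArg (Term.apps · ys) ((t e).subst_weaken f))).trans ?_
  exact h5.trans (h6.symm.trans (e₂ Θ _ (f .zero) ys).symm)

theorem DerivesFun.ora {W : World n} {ρs : List Ty} {τ : Ty} {t : Elem W (arrows ρs τ)}
    (h : DerivesFun W ρs τ t) {δs : List Ty} (hδs : ∀ δ ∈ δs, δ.lev ≤ n) :
    DerivesFun (W.ora δs hδs) ρs τ fun e => t e.1 := by
  obtain ⟨D, hD, hC⟩ := h
  refine ⟨fun e => D e.1, ⟨fun m e e' he => hD.agree m _ _ he.1, fun e => ?_⟩,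
    fun e C he => hC e.1 C he⟩
  exact (hD.openDer e.1).weaken (fun _ h => List.mem_cons_of_mem _ h) (fun _ _ _ _ => rfl)
    (fun _ h => h) id

theorem Derives.var {W : World n} {τ : Ty} {t : Elem W τ} (h : Derives W τ t) {δ : Ty}
    (hδ : δ.lev ≤ n) (hτ : τ.lev ≤ n) : Derives (W.var δ hδ) τ fun e => (t e).weaken :=
  derivesFun_nil_iff.1 ((derivesFun_nil_iff.2 h).var hδ (by simp) hτ)

theorem Derives.ora {W : World n} {τ : Ty} {t : Elem W τ} (h : Derives W τ t) {δs : List Ty}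
    (hδs : ∀ δ ∈ δs, δ.lev ≤ n) : Derives (W.ora δs hδs) τ fun e => t e.1 :=
  derivesFun_nil_iff.1 ((derivesFun_nil_iff.2 h).ora hδs)

theorem derivesFun_id {W : World n} {σ : Ty} (hσ : σ.lev ≤ n) :
    DerivesFun W [σ] σ fun _ => stepT (.id σ) := by
  have hl : ∀ ρ ∈ [σ], ρ.lev ≤ n := by simpa using hσ
  induction W with
  | nil =>
    refine ⟨fun _ => .node (.id σ) [], ⟨fun m _ _ _ => .refl _ _, fun e =>
      OpenDer.node₀ (r := .id σ) rfl ⟨hl, hσ⟩⟩, fun e C he Θ f ys => ?_⟩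
    exact ((Coder.id_apps he Θ).symm).apps (Γ := [σ]) ys
  | var W τ hτ ih => exact ih.var hτ hl hσ
  | ora W δs hδs ih => exact ih.ora hδs

theorem derivesFun_succ {W : World n} : DerivesFun W [.N] .N fun _ => stepT .succ := by
  have hl : ∀ ρ ∈ [Ty.N], ρ.lev ≤ n := by simp [Ty.lev]
  induction W with
  | nil =>
    refine ⟨fun _ => .node .succ [], ⟨fun m _ _ _ => .refl _ _, fun e =>
      OpenDer.node₀ (r := .succ) rfl ⟨hl, Nat.zero_le n⟩⟩, fun e C he Θ f ys => ?_⟩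
    exact ((Coder.succ_apps he Θ).symm).apps (Γ := [.N]) ys
  | var W τ hτ ih => exact ih.var hτ hl (Nat.zero_le n)
  | ora W δs hδs ih => exact ih.ora hδs

theorem derives_zero {W : World n} : Derives W .N fun _ => zeroT := by
  induction W with
  | nil =>
    refine ⟨fun _ => .node .zero [], ⟨fun m _ _ _ => .refl _ _, fun e =>
      OpenDer.node₀ (r := .zero) rfl ⟨by simp [Step.concl], Nat.zero_le n⟩⟩, fun e C he => ?_⟩
    exact (Coder.zero_apps he _).symm
  | var W τ hτ ih => exact ih.var hτ (Nat.zero_le n)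
  | ora W δs hδs ih => exact ih.ora hδs

theorem derives_var {W : World n} {σ : Ty} (hσ : σ.lev ≤ n) :
    Derives (W.var σ hσ) σ fun _ => .var .zero := by
  obtain ⟨D, hD, hC⟩ := derivesFun_id (W := W) hσ
  -- The world with the new variable has the same oracles, so that the derivation can be kept.
  refine ⟨D, ⟨hD.agree, hD.openDer⟩, fun e C he => ?_⟩
  have h := hC e C he (σ :: W.ctx) (fun x => .var x.succ) (.cons (.var .zero) .nil)
  exact (PEq.symm (.eqAxiom (.id σ (.var .zero)))).trans h

theorem Derives.app {W : World n} {σ τ : Ty} (hl : (σ ⇾ τ).lev ≤ n) {t : Elem W (σ ⇾ τ)}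
    {s : Elem W σ} (ht : Derives W (σ ⇾ τ) t) (hs : Derives W σ s) :
    Derives W τ fun e => t e ⬝ s e := by
  have hτ : τ.lev ≤ n := (le_max_right _ _).trans hl
  obtain ⟨D, hD, hDC⟩ := ht
  obtain ⟨E, hE, hEC⟩ := hs
  obtain ⟨I, hI, hIC⟩ := derivesFun_id (W := W) hτ
  have h1 := hE.L le_rfl (ρ := σ) (σ := τ)
    (World.levLE_append (ρs := [σ ⇾ τ]) (by simpa using hl) hτ) hI
  have h2 := hD.cut le_rfl (by simpa using World.levLE_append (ρs := []) (by simp) hτ) h1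
  refine ⟨_, h2, fun e C he => ?_⟩
  obtain ⟨C₁, C₂, h₁, h₂, e₁⟩ := Coder.cut_apps he
  obtain ⟨C₃, C₄, h₃, h₄, e₂⟩ := Coder.L_apps h₂
  refine PEq.symm ((e₁ _ _).trans ((e₂ _ _ _).trans ?_))
  have hid := hIC e C₄ h₄ W.ctx (idSubst n _)
    (.cons (Term.apps (Γ := W.ant) (τ := σ ⇾ τ) C₁.term W.vars ⬝
      Term.apps (Γ := W.ant) C₃.term W.vars) .nil)
  rw [Args.subst_idSubst] at hid
  refine (hid.symm.trans (.eqAxiom (.id τ _))).trans ?_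
  exact (hDC e C₁ h₁).symm.app (hEC e C₃ h₃).symm

theorem Derives.abs {W : World n} {σ τ : Ty} {hσ : σ.lev ≤ n} (hl : (σ ⇾ τ).lev ≤ n)
    {t : Elem W (σ ⇾ τ)} (h : Derives (W.var σ hσ) τ fun e => (t e).weaken ⬝ .var .zero) :
    Derives W (σ ⇾ τ) t := by
  obtain ⟨D, hD, hC⟩ := h
  have h1 : UniformDer W ⟨W.ant ++ [σ], τ⟩ D := ⟨hD.agree, hD.openDer⟩
  refine ⟨_, h1.R le_rfl (by simpa using World.levLE_append (ρs := []) (by simp) hl),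
    fun e C he => .ext ?_⟩
  obtain ⟨C₁, h₁, e₁⟩ := Coder.R_apps he
  refine (hC e C₁ h₁).trans (PEq.trans (e₁ _ _ _).symm (.of_eq ?_))
  refine congrArg (· ⬝ Term.var .zero) ?_
  rw [Term.weaken_eq_subst]
  exact (Term.subst_apps (Γ := W.ant) (τ := σ ⇾ τ) _ C.term W.vars).symm

theorem DerivesFun.app {W : World n} {σ : Ty} {ρs : List Ty} {τ : Ty} (hσ : σ.lev ≤ n)
    (hρs : ∀ ρ ∈ ρs, ρ.lev ≤ n) (hτ : τ.lev ≤ n) {t : Elem W (σ ⇾ arrows ρs τ)} {s : Elem W σ}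
    (ht : DerivesFun W (σ :: ρs) τ t) (hs : Derives W σ s) :
    DerivesFun W ρs τ fun e => t e ⬝ s e := by
  obtain ⟨D, hD, hDC⟩ := ht
  obtain ⟨E, hE, hEC⟩ := hs
  obtain ⟨E', hE', hEC'⟩ := hE.exists_wk_append ρs le_rfl (World.levLE_append hρs hσ)
  have h1 := hD.moveLeft le_rfl
    (World.levLE_append (by simpa [or_imp, forall_and] using ⟨hρs, hσ⟩) hτ)
  rw [← List.append_assoc] at h1
  refine ⟨_, hE'.cut (by simp) (World.levLE_append hρs hτ) h1, fun e C he Θ f ys => ?_⟩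
  obtain ⟨C₁, C₂, h₁, h₂, e₁⟩ := Coder.cut_apps he
  obtain ⟨C₃, h₃, e₃⟩ := hEC' _ C₁ h₁
  obtain ⟨C₄, h₄⟩ := C₂.exists_cast (S' := ⟨W.ant ++ (ρs ++ [σ]), τ⟩) (by simp)
  obtain ⟨C₅, h₅, e₅⟩ := Coder.moveLeft_apps (h₄.trans h₂)
  have e6 := e₁ Θ ((Args.subst f W.vars).append ys)
  rw [HList.append_snoc, Coder.apps_cast _ h₄.symm] at e6
  have e7 := e₅ Θ (Args.subst f W.vars)
    (Term.apps (Γ := W.ant ++ ρs) C₁.term ((Args.subst f W.vars).append ys)) ys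
  have e8 : PEq (Term.apps (Γ := W.ant ++ ρs) C₁.term ((Args.subst f W.vars).append ys))
      ((s e).subst f) := by
    refine (e₃ Θ _ ys).trans (PEq.symm ?_)
    exact Coder.subst_apps (hEC e C₃ h₃) f
  have e9 := hDC e C₅ h₅ Θ f (.cons ((s e).subst f) ys)
  exact PEq.symm ((e6.trans e7).trans ((PEq.apps_append_cons _ _ e8 ys).trans e9.symm))

/-! ### The logical relation -/

/-- Extensions of a world, by further variables and oracles. -/
inductive WorldExt : World n → World n → Type
  | refl (W : World n) : WorldExt W W
  | var {W W' : World n} (e : WorldExt W W') (σ : Ty) (h : σ.lev ≤ n) : WorldExt W (W'.var σ h)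
  | ora {W W' : World n} (e : WorldExt W W') (ρs : List Ty) (h : ∀ ρ ∈ ρs, ρ.lev ≤ n) :
      WorldExt W (W'.ora ρs h)

namespace WorldExt

/-- Composition of extensions. -/
def trans {W W' W'' : World n} (e : WorldExt W W') : WorldExt W' W'' → WorldExt W W''
  | refl _ => e
  | var e' σ h => (e.trans e').var σ h
  | ora e' ρs h => (e.trans e').ora ρs h

/-- An element of a world as an element of an extension. -/
def act {σ : Ty} {W W' : World n} : WorldExt W W' → Elem W σ → Elem W' σ
  | refl _, t => t
  | var e _ _, t => fun env => (e.act t env).weaken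
  | ora e _ _, t => fun env => e.act t env.1

theorem act_trans {σ : Ty} {W W' W'' : World n} (e : WorldExt W W') (e' : WorldExt W' W'')
    (t : Elem W σ) : (e.trans e').act t = e'.act (e.act t) := by
  induction e' with
  | refl => rfl
  | var e' σ h ih => simp only [act, trans, ih]; rfl
  | ora e' ρs h ih => simp only [act, trans, ih]; rfl

theorem act_app {σ τ : Ty} {W W' : World n} (e : WorldExt W W') (t : Elem W (σ ⇾ τ))
    (s : Elem W σ) :
    e.act (fun env => t env ⬝ s env) = fun env => e.act t env ⬝ e.act s env := by
  induction e with
  | refl => rfl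
  | var e σ h ih => simp only [act, ih]; rfl
  | ora e ρs h ih => simp only [act, ih]; rfl

theorem act_con {W W' : World n} (e : WorldExt W W') (c : Cst n) :
    e.act (fun _ => .con c) = fun _ => .con c := by
  induction e with
  | refl => rfl
  | var e σ h ih => simp only [act, ih]; rfl
  | ora e ρs h ih => simp only [act, ih]; rfl

theorem act_congr {σ : Ty} {W W' : World n} (e : WorldExt W W') {t t' : Elem W σ}
    (h : ∀ env, PEq (t env) (t' env)) (env : W'.Env) : PEq (e.act t env) (e.act t' env) := by
  induction e with
  | refl => exact h env
  | var e σ _ ih => exact (ih env).weaken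
  | ora e ρs _ ih => exact ih env.1

end WorldExt

theorem DerivesFun.act {W W' : World n} (e : WorldExt W W') {ρs : List Ty} {τ : Ty}
    (hρs : ∀ ρ ∈ ρs, ρ.lev ≤ n) (hτ : τ.lev ≤ n) {t : Elem W (arrows ρs τ)}
    (h : DerivesFun W ρs τ t) : DerivesFun W' ρs τ (e.act t) := by
  induction e with
  | refl => exact h
  | var e σ hσ ih => exact ih.var hσ hρs hτ
  | ora e δs hδs ih => exact ih.ora hδs

theorem Derives.act {W W' : World n} (e : WorldExt W W') {τ : Ty} (hτ : τ.lev ≤ n) {t : Elem W τ}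
    (h : Derives W τ t) : Derives W' τ (e.act t) :=
  derivesFun_nil_iff.1 ((derivesFun_nil_iff.2 h).act e (by simp) hτ)

/-- The Kripke logical relation over worlds with derivability at the base type. -/
def Computable : (σ : Ty) → (W : World n) → Elem W σ → Prop
  | .N, W, t => Derives W .N t
  | .arr σ τ, W, t => ∀ (W' : World n) (e : WorldExt W W') (s : Elem W' σ), Computable σ W' s →
      Computable τ W' fun env => e.act t env ⬝ s env

namespace Computable

theorem congr {σ : Ty} {W : World n} {t t' : Elem W σ} (h : Computable σ W t)
    (ht : ∀ env, PEq (t env) (t' env)) : Computable σ W t' := by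
  induction σ generalizing W with
  | N => exact Derives.congr h ht
  | arr σ τ _ ih =>
    intro W' e s hs
    exact ih (h W' e s hs) fun env => (e.act_congr ht env).app (.refl _)

theorem act {σ : Ty} {W W' : World n} (e : WorldExt W W') {t : Elem W σ} (h : Computable σ W t) :
    Computable σ W' (e.act t) := by
  cases σ with
  | N => exact Derives.act (τ := .N) e (Nat.zero_le n) h
  | arr σ τ =>
    intro W'' e' s hs
    rw [← WorldExt.act_trans]
    exact h W'' (e.trans e') s hs

theorem app {σ τ : Ty} {W : World n} {t : Elem W (σ ⇾ τ)} {s : Elem W σ}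
    (h : Computable (σ ⇾ τ) W t) (hs : Computable σ W s) :
    Computable τ W fun env => t env ⬝ s env :=
  h W (.refl W) s hs

/-- At types of level at most `n`, computability coincides with derivability. -/
theorem iff_derives {σ : Ty} (hσ : σ.lev ≤ n) {W : World n} {t : Elem W σ} :
    Computable σ W t ↔ Derives W σ t := by
  induction σ generalizing W with
  | N => exact Iff.rfl
  | arr σ τ ihσ ihτ =>
    have hτ' : τ.lev ≤ n := (le_max_right _ _).trans hσ
    have hσ' : σ.lev ≤ n := (Nat.le_add_left _ 1).trans ((le_max_left _ _).trans hσ)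
    constructor
    · intro h
      exact Derives.abs (hσ := hσ') hσ ((ihτ hτ').1
        (h _ ((WorldExt.refl W).var σ hσ') _ ((ihσ hσ').2 (derives_var hσ'))))
    · intro h W' e s hs
      exact (ihτ hτ').2 ((h.act e hσ).app hσ ((ihσ hσ').1 hs))

/-- A derivation with arguments of level at most `n` is computable, although the type of the
function may have level `n + 1`. -/
theorem of_derivesFun {ρs : List Ty} (hρs : ∀ ρ ∈ ρs, ρ.lev ≤ n) {W : World n}
    {t : Elem W (arrows ρs .N)} (h : DerivesFun W ρs .N t) : Computable (arrows ρs .N) W t := by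
  induction ρs generalizing W with
  | nil => exact derivesFun_nil_iff.1 h
  | cons ρ ρs ih =>
    intro W' e s hs
    have hρ : ρ.lev ≤ n := hρs ρ (by simp)
    have hρs' : ∀ ρ ∈ ρs, ρ.lev ≤ n := fun σ hσ => hρs σ (by simp [hσ])
    exact ih hρs' (DerivesFun.app (τ := .N) hρ hρs' (Nat.zero_le n)
      (DerivesFun.act (τ := .N) e hρs (Nat.zero_le n) h) ((iff_derives hρ).1 hs))

/-- A computable function with arguments of level at most `n` has a derivation, although its type
may have level `n + 1`: the arguments are replaced by variables. -/
theorem derivesFun {ρs : List Ty} (hρs : ∀ ρ ∈ ρs, ρ.lev ≤ n) {τ : Ty} (hτ : τ.lev ≤ n)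
    {W : World n} {t : Elem W (arrows ρs τ)} (h : Computable (arrows ρs τ) W t) :
    DerivesFun W ρs τ t := by
  induction ρs generalizing W with
  | nil => exact derivesFun_nil_iff.2 ((iff_derives hτ).1 h)
  | cons ρ ρs ih =>
    have hρ : ρ.lev ≤ n := hρs ρ (by simp)
    exact DerivesFun.cons_of_var (hσ := hρ) (ih (fun σ hσ => hρs σ (by simp [hσ]))
      (h _ ((WorldExt.refl W).var ρ hρ) _ ((iff_derives hρ).2 (derives_var hρ))))

end Computable

/-! ### Recursion -/

/-- One round of the loop that replaces a recursor: a case distinction between a derivation `A` of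
`Γ, ρs ⇒ N` and a derivation `B` of `Γ, N, ρs ⇒ N`. -/
def loopStep (Γ ρs : List Ty) (A B : CoTree) : CoTree :=
  .moveRight Γ .N ρs .N (.node (.cond (Γ ++ ρs) .N) [A, .moveLeft Γ .N ρs .N B])

theorem CoTree.Agree.loopStep {m : ℕ} {A A' B B' : CoTree} (hA : Agree m A A')
    (hB : Agree m B B') (Γ ρs : List Ty) :
    Agree (m + 1) (loopStep Γ ρs A B) (loopStep Γ ρs A' B') :=
  (hA.node₂ (hB.moveLeft _ _ _ _) _).moveRight _ _ _ _

/-- If the derivation of the step case uses `E` as an oracle, then so does the round, and it is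
guarded and passes through the case distinction on the variable of type `N`. -/
theorem loopStep_openDer {O : List Oracle} {E : Oracle} {Γ ρs : List Ty} {A B : CoTree}
    (hlev : (⟨Γ ++ .N :: ρs, .N⟩ : Sequent).LevLE n) (hE : E.len = Γ.length + 1)
    (hO : ∀ E' ∈ O, E'.len ≤ Γ.length)
    (hA : OpenDer n O ⟨Γ ++ ρs, .N⟩ (fun p => p) (fun _ => False) False A)
    (hB : OpenDer n (E :: O) ⟨Γ ++ .N :: ρs, .N⟩ (fun p => p) (fun _ => False) False B) :
    OpenDer n (E :: O) ⟨Γ ++ .N :: ρs, .N⟩ (fun p => p) (fun p => p = Γ.length) True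
      (loopStep Γ ρs A B) := by
  have hO' : ∀ E' ∈ E :: O, E'.len ≤ Γ.length + 1 := by
    intro E' hE'
    rcases List.mem_cons.1 hE' with rfl | h
    · exact hE.le
    · exact (hO E' h).trans (Nat.le_succ _)
  have hlev' : (⟨Γ ++ (ρs ++ [.N]), .N⟩ : Sequent).LevLE n := by
    refine ⟨fun σ hσ => hlev.1 σ ?_, hlev.2⟩
    simp only [List.mem_append, List.mem_cons, List.not_mem_nil, or_false] at hσ ⊢
    tauto
  -- In `Γ, ρs, N`, the variable at position `Γ.length` is the last one.
  have h1 := hB.moveLeft (g := fun p => if p < Γ.length then p else Γ.length + ρs.length) hlev'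
    fun E' hE' p hp => by
      have := hO' E' hE'
      split_ifs <;> omega
  rw [← List.append_assoc] at h1 hlev'
  have h2 : OpenDer n (E :: O) ⟨(Γ ++ ρs) ++ [.N], .N⟩
      (fun p => if p < Γ.length then p else Γ.length + ρs.length) (fun p => p = Γ.length) True
      (.node (.cond (Γ ++ ρs) .N) [A, .moveLeft Γ .N ρs .N B]) := by
    refine OpenDer.node₂ (r := .cond (Γ ++ ρs) .N) rfl hlev' (List.subset_cons_self E O)
      (List.Subset.refl _) hA h1 (fun E' hE' p hp => ?_) (fun E' hE' p hp => ?_)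
    · have := hO E' hE'
      refine ⟨.inl ⟨rfl, ?_, ?_⟩, fun h => ?_⟩
      · rw [if_pos (by omega), List.length_append]; omega
      · rw [if_pos (by omega)]
      · omega
    · have := hO' E' hE'
      refine ⟨.inr ⟨rfl, ?_, rfl⟩, fun h => .inr ?_⟩
      · rw [List.length_append]; split_ifs <;> omega
      · rw [if_neg (by omega)]; exact List.length_append.symm
  rw [List.append_assoc] at h2
  exact h2.moveRight hlev fun E' hE' p hp => by
    have := hO' E' hE'
    split_ifs <;> omega

/-- The equations for the loop: at `0` it is the derivation `A`, and at a successor the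
derivation `B`. -/
theorem Coder.loopStep_apps {Γ ρs : List Ty} {A B : CoTree} {C : Coder n ⟨Γ ++ .N :: ρs, .N⟩}
    (h : C.tree = loopStep Γ ρs A B) :
    ∃ (D : Coder n ⟨Γ ++ ρs, .N⟩) (E : Coder n ⟨Γ ++ .N :: ρs, .N⟩), D.tree = A ∧ E.tree = B ∧
      ∀ (Ξ : List Ty) (xs : Args n Ξ Γ) (ys : Args n Ξ ρs),
        PEq (Term.apps (Γ := Γ ++ .N :: ρs) C.term (xs.append (.cons zeroT ys)))
          (Term.apps (Γ := Γ ++ ρs) D.term (xs.append ys)) ∧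
        ∀ y, PEq (Term.apps (Γ := Γ ++ .N :: ρs) C.term (xs.append (.cons (succT y) ys)))
          (Term.apps (Γ := Γ ++ .N :: ρs) E.term (xs.append (.cons y ys))) := by
  obtain ⟨C₁, h₁, e₁⟩ := Coder.moveRight_apps h
  obtain ⟨C₂, h₂⟩ := C₁.exists_cast (S' := ⟨(Γ ++ ρs) ++ [.N], .N⟩) (by simp)
  obtain ⟨D, C₃, hD, h₃, e₃⟩ := Coder.cond_apps (h₂.trans h₁)
  obtain ⟨C₄, h₄⟩ := C₃.exists_cast (S' := ⟨Γ ++ (ρs ++ [.N]), .N⟩) (by simp)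
  obtain ⟨E, hE, e₄⟩ := Coder.moveLeft_apps (h₄.trans h₃)
  refine ⟨D, E, hD, hE, fun Ξ xs ys => ⟨?_, fun y => ?_⟩⟩
  · have e := (e₃ Ξ (xs.append ys)).1
    rw [HList.append_snoc, Coder.apps_cast _ h₂] at e
    exact (e₁ Ξ xs zeroT ys).trans e
  · have e := (e₃ Ξ (xs.append ys)).2 y
    rw [HList.append_snoc, HList.append_snoc, Coder.apps_cast _ h₂,
      Coder.apps_cast _ h₄.symm] at e
    exact (e₁ Ξ xs (succT y) ys).trans (e.trans (e₄ Ξ xs y ys))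

/-- A coderivation of `Γ, ρs ⇒ τ` as a term of type `ρs → τ`, for given arguments of types `Γ`. -/
def Coder.partialApps {Γ ρs : List Ty} {τ : Ty} (C : Coder n ⟨Γ ++ ρs, τ⟩) {Ξ : List Ty}
    (xs : Args n Ξ Γ) : Term n Ξ (arrows ρs τ) :=
  Term.apps (Γ := Γ) (Term.cast (arrows_append Γ ρs τ) C.term) xs

theorem Coder.partialApps_apps {Γ ρs : List Ty} {τ : Ty} (C : Coder n ⟨Γ ++ ρs, τ⟩)
    {Ξ : List Ty} (xs : Args n Ξ Γ) (ys : Args n Ξ ρs) :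
    (C.partialApps xs).apps ys = Term.apps (Γ := Γ ++ ρs) C.term (xs.append ys) :=
  (Term.apps_append (Γ := Γ) (Δ := ρs) C.term xs ys).symm

theorem Coder.subst_partialApps {Γ ρs : List Ty} {τ : Ty} (C : Coder n ⟨Γ ++ ρs, τ⟩)
    {Ξ Θ : List Ty} (f : Subst n Ξ Θ) (xs : Args n Ξ Γ) :
    (C.partialApps xs).subst f = C.partialApps (Args.subst f xs) := by
  refine (Term.subst_apps (Γ := Γ) f _ xs).trans ?_
  exact congrArg (fun t => Term.apps (Γ := Γ) t (Args.subst f xs))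
    (Term.subst_cast f (arrows_append Γ ρs τ) C.term)

/-- The most recent oracle of a world, as a function of the arguments `ρs`. -/
def oracleElem (W : World n) (ρs : List Ty) (hρs : ∀ ρ ∈ ρs, ρ.lev ≤ n) :
    Elem (W.ora ρs hρs) (arrows ρs .N) :=
  fun e => e.2.partialApps W.vars

theorem derivesFun_oracleElem (W : World n) (ρs : List Ty) (hρs : ∀ ρ ∈ ρs, ρ.lev ≤ n) :
    DerivesFun (W.ora ρs hρs) ρs .N (oracleElem W ρs hρs) := by
  refine ⟨fun e => e.2, ⟨fun m e e' he => he.2, fun e =>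
    OpenDer.oracle (E := ⟨e.2, ⟨W.ant ++ ρs, .N⟩, W.ant.length⟩) List.mem_cons_self⟩,
    fun e C he Θ f ys => .of_eq ?_⟩
  rw [Coder.ext (C := C) (D := e.2) he]
  have h1 : (oracleElem W ρs hρs e).subst f = e.2.partialApps (Args.subst f W.vars) :=
    Coder.subst_partialApps _ _ _
  rw [h1, Coder.partialApps_apps]
  rfl

/-- A function on `N` that satisfies recursion equations with computable data is derived by the
loop in which the derivation of the step calls the loop itself as an oracle. -/
theorem derivesFun_of_recursion {ρs : List Ty} (hρs : ∀ ρ ∈ ρs, ρ.lev ≤ n) (hN : Ty.N.lev ≤ n)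
    {W : World n}
    {a : Elem W (arrows ρs .N)} {f : Elem W (.N ⇾ arrows ρs .N ⇾ arrows ρs .N)}
    {r : Elem W (.N ⇾ arrows ρs .N)} (ha : DerivesFun W ρs .N a)
    (hf : DerivesFun ((W.var .N hN).ora ρs hρs) ρs .N fun e =>
      (f e.1).weaken ⬝ .var .zero ⬝ oracleElem (W.var .N hN) ρs hρs e)
    (hr₀ : ∀ e, PEq (r e ⬝ zeroT) (a e))
    (hr : ∀ e, PEq (Ξ := .N :: W.ctx) ((r e).weaken ⬝ succT (.var .zero))
      ((f e).weaken ⬝ .var .zero ⬝ ((r e).weaken ⬝ .var .zero))) :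
    DerivesFun W (.N :: ρs) .N r := by
  obtain ⟨A, hA, hAC⟩ := ha
  obtain ⟨B, hB, hBC⟩ := hf
  have hant : ((W.var .N hN).ora ρs hρs).ant ++ ρs = W.ant ++ .N :: ρs := by simp [World.ant]
  have hlev : (⟨W.ant ++ .N :: ρs, .N⟩ : Sequent).LevLE n :=
    World.levLE_append (by simpa using ⟨hN, hρs⟩) hN
  let G : W.TreeEnv → CoTree → CoTree := fun e T => loopStep W.ant ρs (A e) (B (e, T))
  have hG : ∀ m e e' T T', W.Agree m e e' → CoTree.Agree m T T' →
      CoTree.Agree (m + 1) (G e T) (G e' T') := fun m e e' T T' he hT =>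
    (hA.agree m e e' he).loopStep (hB.agree m (e, T) (e', T') ⟨he, hT⟩) _ _
  let F : W.TreeEnv → CoTree := fun e => CoTree.fix (G e)
  have hF : ∀ e, F e = G e (F e) := fun e =>
    CoTree.fix_eq fun m T U h => hG m e e T U (.refl m e) h
  refine ⟨F, ⟨fun m e e' he => ?_, fun e => ?_⟩, fun e C hC Θ g ys => ?_⟩
  · have : ∀ k ≤ m, CoTree.Agree k (F e) (F e') := by
      intro k
      induction k with
      | zero => intro _ a ha; simp at ha
      | succ k ih =>
        intro hk
        rw [hF e, hF e']
        exact hG k _ _ _ _ (he.mono (by omega)) (ih (by omega))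
    exact this m le_rfl
  · -- Each return to the root passes through the case distinction on the variable of type `N`.
    have h1 := hB.openDer (e, F e)
    rw [hant] at h1
    have h2 := loopStep_openDer hlev (by simp [World.ant])
      (fun E' hE' => World.len_le_of_mem_oracles hE') (hA.openDer e) h1
    rw [show loopStep W.ant ρs (A e) (B (e, F e)) = F e from (hF e).symm] at h2
    have h3 : (⟨(W.var .N hN).ant ++ ρs, .N⟩ : Sequent) = ⟨W.ant ++ .N :: ρs, .N⟩ := by
      simp [World.ant]
    rw [← h3] at h2 ⊢
    refine OpenDer.of_self (E := ⟨F e, _, (W.var .N hN).ant.length⟩) h2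
      (p₀ := W.ant.length) (by simp [World.ant]) rfl fun E' hE' => ?_
    exact (World.len_le_of_mem_oracles hE').trans (by simp [World.ant])
  · -- The loop satisfies the recursion equations, if `C` itself is plugged in for the oracle.
    obtain ⟨C', hC'⟩ := C.exists_cast (S' := ⟨(W.var .N hN).ant ++ ρs, .N⟩) (by simp [World.ant])
    obtain ⟨D, E, hD, hE, hDE⟩ := Coder.loopStep_apps (hC.trans (hF _))
    obtain ⟨E', hE'⟩ := E.exists_cast (S' := ⟨((W.var .N hN).ora ρs hρs).ant ++ ρs, .N⟩)
      (by rw [hant])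
    have hB' := hBC (e, C') E' (by
      rw [hE', hE]
      change B (W.trees e, F (W.trees e)) = B (W.trees e, C'.tree)
      rw [hC', hC])
    -- The loop as a function on `N`, in the variables of `W`.
    let s : Term n W.ctx (.N ⇾ arrows ρs .N) := Coder.partialApps (ρs := .N :: ρs) C W.vars
    have hs : ∀ {Θ : List Ty} (f : Subst n W.ctx Θ) (y : Term n Θ .N) (ys : Args n Θ ρs),
        (s.subst f ⬝ y).apps ys = Term.apps (Γ := W.ant ++ .N :: ρs) C.term
          ((Args.subst f W.vars).append (.cons y ys)) := by
      intro Θ f y ys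
      have h1 : s.subst f = Coder.partialApps (ρs := .N :: ρs) C (Args.subst f W.vars) :=
        Coder.subst_partialApps _ _ _
      rw [h1]
      exact Coder.partialApps_apps (ρs := .N :: ρs) C _ (.cons y ys)
    have hcast : ∀ {Θ : List Ty} (f : Subst n (.N :: W.ctx) Θ) (ys : Args n Θ ρs)
        {K : Coder n ⟨W.ant ++ .N :: ρs, .N⟩} {K' : Coder n ⟨(W.var .N hN).ant ++ ρs, .N⟩},
        K'.tree = K.tree → Term.apps (Γ := (W.var .N hN).ant ++ ρs) K'.term
          ((Args.subst (Ξ := (W.var .N hN).ctx) f (W.var .N hN).vars).append ys) =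
        Term.apps (Γ := W.ant ++ .N :: ρs) K.term
          ((Args.subst (fun x => f x.succ) W.vars).append (.cons (f .zero) ys)) := by
      intro Θ f ys K K' hK
      rw [World.subst_vars_var]
      have h1 := HList.snoc_append (Args.subst (fun x => f x.succ) W.vars) (f .zero) ys
      have h2 := Coder.apps_cast (List.append_cons _ _ _) hK
        ((Args.subst (fun x => f x.succ) W.vars).append (.cons (f .zero) ys))
      rw [← h1] at h2
      exact h2
    have hs₀ : PEq (s ⬝ zeroT) (a e) := by
      refine .of_apps fun Θ f ys => ?_
      refine (PEq.of_eq (hs f zeroT ys)).trans ?_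
      exact (hDE Θ _ ys).1.trans (hAC e D hD Θ f ys).symm
    have hz : PEq (oracleElem (W.var .N hN) ρs hρs (e, C')) (s.weaken ⬝ .var .zero) := by
      refine .of_apps fun Θ f ys => .of_eq ?_
      have h1 : (oracleElem (W.var .N hN) ρs hρs (e, C')).subst f =
          C'.partialApps (Args.subst f (W.var .N hN).vars) := Coder.subst_partialApps _ _ _
      have h2 : (s.weaken ⬝ .var .zero).subst f = s.subst (fun x => f x.succ) ⬝ f .zero :=
        congrArg (· ⬝ f .zero) (s.subst_weaken f)
      rw [h1, Coder.partialApps_apps]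
      refine (hcast f ys hC').trans ?_
      exact (hs _ (f .zero) ys).symm.trans (congrArg (Term.apps · ys) h2.symm)
    have hs₁ : PEq (Ξ := .N :: W.ctx) (s.weaken ⬝ succT (.var .zero))
        ((f e).weaken ⬝ .var .zero ⬝ (s.weaken ⬝ .var .zero)) := by
      refine PEq.trans ?_ ((PEq.refl _).app hz)
      refine .of_apps fun Θ h ys => ?_
      have h2 : (s.weaken ⬝ succT (.var .zero)).subst h =
          s.subst (fun x => h x.succ) ⬝ succT (h .zero) :=
        congrArg (· ⬝ succT (h .zero)) (s.subst_weaken h)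
      refine (PEq.of_eq (congrArg (Term.apps · ys) h2)).trans ?_
      refine (PEq.of_eq (hs _ _ ys)).trans (((hDE Θ _ ys).2 _).trans ?_)
      have h3 := hB' Θ h ys
      exact (PEq.of_eq (hcast h ys hE').symm).trans h3.symm
    have hsr : PEq s (r e) := PEq.of_recursion hs₀ (hr₀ e) hs₁ (hr e)
    rcases ys with _ | ⟨y, ys⟩
    refine PEq.trans ?_ (.of_eq (hs g y ys))
    exact ((hsr.symm.subst g).app (.refl y)).apps ys

/-- The arguments of a type of level at most `n + 1` have level at most `n`. -/
theorem lev_le_of_arrows {Γ : List Ty} {τ : Ty} (h : (arrows Γ τ).lev ≤ n + 1) :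
    ∀ ρ ∈ Γ, ρ.lev ≤ n := by
  induction Γ with
  | nil => simp
  | cons σ Γ ih =>
    simp only [arrows, Ty.lev, Nat.max_le] at h
    rintro ρ (_ | ⟨_, hρ⟩)
    · omega
    · exact ih h.2 ρ hρ

/-- Recursion at a type of level at most `n + 1` preserves computability. -/
theorem Computable.of_recursion {τ : Ty} (hτ : τ.lev ≤ n + 1) {W : World n} {a : Elem W τ}
    {f : Elem W (.N ⇾ τ ⇾ τ)} {r : Elem W (.N ⇾ τ)} (ha : Computable τ W a)
    (hf : Computable (.N ⇾ τ ⇾ τ) W f) (hr₀ : ∀ e, PEq (r e ⬝ zeroT) (a e))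
    (hr : ∀ e, PEq (Ξ := .N :: W.ctx) ((r e).weaken ⬝ succT (.var .zero))
      ((f e).weaken ⬝ .var .zero ⬝ ((r e).weaken ⬝ .var .zero))) :
    Computable (.N ⇾ τ) W r := by
  have hN : Ty.N.lev ≤ n := Nat.zero_le n
  obtain ⟨ρs, hρs, rfl⟩ : ∃ ρs : List Ty, (∀ ρ ∈ ρs, ρ.lev ≤ n) ∧ arrows ρs .N = τ :=
    ⟨τ.args, lev_le_of_arrows (by rwa [arrows_args]), arrows_args τ⟩
  -- The recursive value is represented by an oracle, which is computable.
  have hz := of_derivesFun hρs (derivesFun_oracleElem (W.var .N hN) ρs hρs)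
  have hy : Computable .N ((W.var .N hN).ora ρs hρs) fun _ => .var .zero :=
    (derives_var hN).ora hρs
  have hfyz := (hf _ (((WorldExt.refl W).var .N hN).ora ρs hρs) _ hy).app hz
  exact of_derivesFun (ρs := .N :: ρs) (by simpa using ⟨hN, hρs⟩)
    (derivesFun_of_recursion hρs hN (derivesFun hρs hN ha) (derivesFun hρs hN hfyz) hr₀ hr)

/-! ### Computability of the terms of `T_{n+1}` -/

/-- Vectors of computable terms. -/
inductive ComputableArgs (W : World n) : (Γ : List Ty) → (W.Env → Args n W.ctx Γ) → Prop
  | nil : ComputableArgs W [] fun _ => .nil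
  | cons {σ : Ty} {Γ : List Ty} {x : Elem W σ} {xs : W.Env → Args n W.ctx Γ} :
      Computable σ W x → ComputableArgs W Γ xs →
        ComputableArgs W (σ :: Γ) fun e => .cons (x e) (xs e)

namespace ComputableArgs

variable {W : World n}

theorem append {Γ Δ : List Ty} {xs : W.Env → Args n W.ctx Γ} {ys : W.Env → Args n W.ctx Δ}
    (hx : ComputableArgs W Γ xs) (hy : ComputableArgs W Δ ys) :
    ComputableArgs W (Γ ++ Δ) fun e => (xs e).append (ys e) := by
  induction hx with
  | nil => exact hy
  | cons h _ ih => exact .cons h ih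

theorem exists_append {Γ Δ : List Ty} {xs : W.Env → Args n W.ctx (Γ ++ Δ)}
    (h : ComputableArgs W (Γ ++ Δ) xs) : ∃ ys zs, ComputableArgs W Γ ys ∧
      ComputableArgs W Δ zs ∧ xs = fun e => (ys e).append (zs e) := by
  induction Γ with
  | nil => exact ⟨_, xs, .nil, h, rfl⟩
  | cons σ Γ ih =>
    rcases h with _ | ⟨hx, h⟩
    obtain ⟨ys, zs, hy, hz, rfl⟩ := ih h
    exact ⟨_, zs, .cons hx hy, hz, rfl⟩

theorem exists_snoc {Γ : List Ty} {σ : Ty} {xs : W.Env → Args n W.ctx (Γ ++ [σ])}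
    (h : ComputableArgs W (Γ ++ [σ]) xs) : ∃ ys x, ComputableArgs W Γ ys ∧
      Computable σ W x ∧ xs = fun e => (ys e).snoc (x e) := by
  obtain ⟨ys, zs, hy, hz, rfl⟩ := h.exists_append
  rcases hz with _ | ⟨hx, _ | _⟩
  exact ⟨ys, _, hy, hx, rfl⟩

theorem snoc {Γ : List Ty} {σ : Ty} {xs : W.Env → Args n W.ctx Γ} {x : Elem W σ}
    (hx : ComputableArgs W Γ xs) (h : Computable σ W x) :
    ComputableArgs W (Γ ++ [σ]) fun e => (xs e).snoc (x e) :=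
  hx.append (.cons h .nil)

end ComputableArgs

namespace Computable

variable {W : World n}

theorem cast {σ τ : Ty} (h : σ = τ) {t : Elem W σ} (ht : Computable σ W t) :
    Computable τ W fun e => (t e).cast h := by
  subst h; exact ht

theorem apps {Γ : List Ty} {τ : Ty} {t : Elem W (arrows Γ τ)} {xs : W.Env → Args n W.ctx Γ}
    (ht : Computable (arrows Γ τ) W t) (hx : ComputableArgs W Γ xs) :
    Computable τ W fun e => (t e).apps (xs e) := by
  induction hx with
  | nil => exact ht
  | cons h _ ih => exact ih (ht.app h)

/-- Functions of several arguments are computable if their values are. -/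
theorem of_apps {Γ : List Ty} {τ : Ty} {t : Elem W (arrows Γ τ)}
    (h : ∀ (W' : World n) (e : WorldExt W W') (xs : W'.Env → Args n W'.ctx Γ),
      ComputableArgs W' Γ xs → Computable τ W' fun env => (e.act t env).apps (xs env)) :
    Computable (arrows Γ τ) W t := by
  induction Γ generalizing W with
  | nil => exact h W (.refl W) _ .nil
  | cons σ Γ ih =>
    intro W' e s hs
    refine ih fun W'' e' xs hx => ?_
    have h1 := h W'' (e.trans e') _ (.cons (hs.act e') hx)
    rw [WorldExt.act_trans] at h1
    have h2 := WorldExt.act_app (σ := σ) (τ := arrows Γ τ) e' (e.act t) s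
    rw [h2]
    exact h1

/-- As `of_apps`, with one more argument of the value. -/
theorem of_apps_app {Γ : List Ty} {σ τ : Ty} {t : Elem W (arrows Γ (σ ⇾ τ))}
    (h : ∀ (W' : World n) (e : WorldExt W W') (xs : W'.Env → Args n W'.ctx Γ) (x : Elem W' σ),
      ComputableArgs W' Γ xs → Computable σ W' x →
        Computable τ W' fun env => Term.apps (τ := σ ⇾ τ) (e.act t env) (xs env) ⬝ x env) :
    Computable (arrows Γ (σ ⇾ τ)) W t := by
  induction Γ generalizing W with
  | nil => exact fun W' e s hs => h W' e _ s .nil hs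
  | cons ρ Γ ih =>
    intro W' e s hs
    refine ih fun W'' e' xs x hx hx' => ?_
    have h1 := h W'' (e.trans e') _ x (.cons (hs.act e') hx) hx'
    rw [WorldExt.act_trans] at h1
    have h2 := WorldExt.act_app (σ := ρ) (τ := arrows Γ (σ ⇾ τ)) e' (e.act t) s
    rw [h2]
    exact h1

/-- For an element that is present in every world, computability need not be checked in extensions
of a world, since all worlds are considered. -/
theorem of_app_apps {α : Ty} {Γ : List Ty} {τ : Ty}
    {k : ∀ W : World n, Elem W (α ⇾ arrows Γ τ)}
    (hk : ∀ {W W' : World n} (e : WorldExt W W'), e.act (k W) = k W')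
    (h : ∀ (W : World n) (t : Elem W α) (xs : W.Env → Args n W.ctx Γ), Computable α W t →
      ComputableArgs W Γ xs → Computable τ W fun e => (k W e ⬝ t e).apps (xs e)) :
    Computable (α ⇾ arrows Γ τ) W (k W) := by
  intro W' e t ht
  refine of_apps fun W'' e' xs hx => ?_
  rw [hk, WorldExt.act_app, hk]
  exact h W'' _ xs (ht.act e') hx

theorem of_app_app_apps {α β : Ty} {Γ : List Ty} {τ : Ty}
    {k : ∀ W : World n, Elem W (α ⇾ β ⇾ arrows Γ τ)}
    (hk : ∀ {W W' : World n} (e : WorldExt W W'), e.act (k W) = k W')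
    (h : ∀ (W : World n) (s : Elem W α) (t : Elem W β) (xs : W.Env → Args n W.ctx Γ),
      Computable α W s → Computable β W t → ComputableArgs W Γ xs →
        Computable τ W fun e => (k W e ⬝ s e ⬝ t e).apps (xs e)) :
    Computable (α ⇾ β ⇾ arrows Γ τ) W (k W) := by
  intro W₁ e₁ s hs W₂ e₂ t ht
  refine of_apps fun W' e xs hx => ?_
  rw [hk, WorldExt.act_app, WorldExt.act_app, WorldExt.act_app, hk, hk]
  exact h W' _ _ xs ((hs.act e₂).act e) (ht.act e) hx

theorem ex {Γ : List Ty} {ρ σ : Ty} {Δ : List Ty} {τ : Ty} :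
    Computable (Step.ex Γ ρ σ Δ τ).ty W fun _ => stepT (.ex Γ ρ σ Δ τ) := by
  refine of_app_apps (α := arrows (Γ ++ σ :: ρ :: Δ) τ) (Γ := Γ ++ ρ :: σ :: Δ) (τ := τ)
    (k := fun _ _ => stepT (.ex Γ ρ σ Δ τ)) (fun e => e.act_con (.step (.ex Γ ρ σ Δ τ)))
    fun W t xs ht hx => ?_
  obtain ⟨ys, zs, hy, hz, rfl⟩ := hx.exists_append
  rcases hz with _ | ⟨hz, _ | ⟨hz', hzs⟩⟩
  exact (ht.apps (hy.append (.cons hz' (.cons hz hzs)))).congr fun e =>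
    .symm (.eqAxiom (.ex ..))

theorem wk {Γ : List Ty} {σ τ : Ty} :
    Computable (Step.wk Γ σ τ).ty W fun _ => stepT (.wk Γ σ τ) := by
  refine of_app_apps (α := arrows Γ τ) (Γ := Γ ++ [σ]) (τ := τ)
    (k := fun _ _ => stepT (.wk Γ σ τ)) (fun e => e.act_con (.step (.wk Γ σ τ)))
    fun W t xs ht hx => ?_
  obtain ⟨ys, x, hy, hx, rfl⟩ := hx.exists_snoc
  exact (ht.apps hy).congr fun e => .symm (.eqAxiom (.wk Γ σ τ _ _ _))

theorem cntr {Γ : List Ty} {σ τ : Ty} :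
    Computable (Step.cntr Γ σ τ).ty W fun _ => stepT (.cntr Γ σ τ) := by
  refine of_app_apps (α := arrows (Γ ++ [σ, σ]) τ) (Γ := Γ ++ [σ]) (τ := τ)
    (k := fun _ _ => stepT (.cntr Γ σ τ)) (fun e => e.act_con (.step (.cntr Γ σ τ)))
    fun W t xs ht hx => ?_
  obtain ⟨ys, x, hy, hy', rfl⟩ := hx.exists_snoc
  exact (ht.apps (hy.append (.cons hy' (.cons hy' .nil)))).congr fun e =>
    .symm (.eqAxiom (.cntr Γ σ τ _ _ _))

theorem cut {Γ : List Ty} {σ τ : Ty} :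
    Computable (Step.cut Γ σ τ).ty W fun _ => stepT (.cut Γ σ τ) := by
  refine of_app_app_apps (α := arrows Γ σ) (β := arrows (Γ ++ [σ]) τ) (Γ := Γ) (τ := τ)
    (k := fun _ _ => stepT (.cut Γ σ τ)) (fun e => e.act_con (.step (.cut Γ σ τ)))
    fun W s t xs hs ht hx => ?_
  exact (ht.apps (hx.snoc (hs.apps hx))).congr fun e => .symm (.eqAxiom (.cut Γ σ τ _ _ _))

theorem id {σ : Ty} : Computable (Step.id σ).ty W fun _ => stepT (.id σ) := by
  refine of_app_apps (α := σ) (Γ := []) (τ := σ)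
    (k := fun _ _ => stepT (.id σ)) (fun e => e.act_con (.step (.id σ)))
    fun W t xs ht hx => ?_
  rcases hx
  exact ht.congr fun e => .symm (.eqAxiom (.id σ _))

theorem L {Γ : List Ty} {ρ σ τ : Ty} :
    Computable (Step.L Γ ρ σ τ).ty W fun _ => stepT (.L Γ ρ σ τ) := by
  refine of_app_app_apps (α := arrows Γ ρ) (β := arrows (Γ ++ [σ]) τ) (Γ := Γ ++ [ρ ⇾ σ]) (τ := τ)
    (k := fun _ _ => stepT (.L Γ ρ σ τ)) (fun e => e.act_con (.step (.L Γ ρ σ τ)))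
    fun W s t xs hs ht hx => ?_
  obtain ⟨ys, y, hy, hy', rfl⟩ := hx.exists_snoc
  exact (ht.apps (hy.snoc (hy'.app (hs.apps hy)))).congr fun e =>
    .symm (.eqAxiom (.L Γ ρ σ τ _ _ _ _))

theorem R {Γ : List Ty} {σ τ : Ty} :
    Computable (Step.R Γ σ τ).ty W fun _ => stepT (.R Γ σ τ) := by
  intro W₁ e₁ t ht
  refine of_apps_app (Γ := Γ) (σ := σ) (τ := τ) fun W' e xs x hx hx' => ?_
  have h1 := e₁.act_con (.step (.R Γ σ τ))
  have h2 := e.act_con (.step (.R Γ σ τ))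
  have h3 := e.act_app (σ := arrows (Γ ++ [σ]) τ) (τ := arrows Γ (σ ⇾ τ))
    (fun _ => stepT (.R Γ σ τ)) t
  refine ((ht.act e).apps (hx.snoc hx')).congr fun env => ?_
  refine .symm (PEq.trans (.of_eq ?_) (.eqAxiom (.R Γ σ τ (e.act t env) (xs env) (x env))))
  refine congrArg (fun u => Term.apps (Γ := Γ) (τ := σ ⇾ τ) u (xs env) ⬝ x env) ?_
  refine (congrFun (congrArg e.act
    (funext fun env => congrArg (· ⬝ t env) (congrFun h1 env))) env).trans ?_
  refine (congrFun h3 env).trans ?_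
  exact congrArg (· ⬝ e.act t env) (congrFun h2 env)

theorem recursor {Γ : List Ty} {τ : Ty} (hτ : τ.lev ≤ n + 1) :
    Computable (Cst.recursor (n := n) Γ τ hτ).ty W fun _ => .con (.recursor Γ τ hτ) := by
  refine of_app_app_apps (α := arrows Γ τ) (β := arrows (Γ ++ [.N, τ]) τ) (Γ := Γ ++ [.N])
    (τ := τ)
    (k := fun _ _ => .con (.recursor Γ τ hτ)) (fun e => e.act_con (.recursor Γ τ hτ))
    fun W s t xs hs ht hx => ?_
  obtain ⟨ys, m, hy, hm, rfl⟩ := hx.exists_snoc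
  let u : Elem W (arrows (Γ ++ [.N]) τ) := fun e => .con (.recursor Γ τ hτ) ⬝ s e ⬝ t e
  -- For fixed arguments `ys`, the recursor is the function `r` on `N` with the step function `f`.
  let f : Elem W (.N ⇾ τ ⇾ τ) := fun e =>
    Term.apps (Γ := Γ) ((t e).cast (arrows_append Γ [.N, τ] τ)) (ys e)
  let r : Elem W (.N ⇾ τ) := fun e =>
    Term.apps (Γ := Γ) ((u e).cast (arrows_append Γ [.N] τ)) (ys e)
  have hf : ∀ {Θ : List Ty} (g : Subst n W.ctx Θ) (e : W.Env) (y : Term n Θ .N) (z : Term n Θ τ),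
      (f e).subst g ⬝ y ⬝ z = Term.apps (Γ := Γ ++ [.N, τ]) ((t e).subst g)
        ((Args.subst g (ys e)).append (.cons y (.cons z .nil))) := by
    intro Θ g e y z
    refine Eq.trans ?_ (Term.apps_append (Γ := Γ) (Δ := [.N, τ]) ((t e).subst g)
      (Args.subst g (ys e)) (.cons y (.cons z .nil))).symm
    refine congrArg (· ⬝ y ⬝ z) ((Term.subst_apps (Γ := Γ) g _ (ys e)).trans ?_)
    exact congrArg (fun v => Term.apps (Γ := Γ) v (Args.subst g (ys e))) (Term.subst_cast g _ _)
  have hr : ∀ {Θ : List Ty} (g : Subst n W.ctx Θ) (e : W.Env) (y : Term n Θ .N),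
      (r e).subst g ⬝ y = Term.apps (Γ := Γ ++ [.N]) ((u e).subst g)
        ((Args.subst g (ys e)).snoc y) := by
    intro Θ g e y
    refine Eq.trans ?_ (Term.apps_append (Γ := Γ) (Δ := [.N]) ((u e).subst g)
      (Args.subst g (ys e)) (.cons y .nil)).symm
    refine congrArg (· ⬝ y) ((Term.subst_apps (Γ := Γ) g _ (ys e)).trans ?_)
    exact congrArg (fun v => Term.apps (Γ := Γ) v (Args.subst g (ys e))) (Term.subst_cast g _ _)
  have hr' : ∀ e (y : Term n W.ctx .N), r e ⬝ y = Term.apps (Γ := Γ ++ [.N]) (u e)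
      ((ys e).snoc y) := fun e y => (Term.apps_append (Γ := Γ) (Δ := [.N]) (u e) (ys e)
        (.cons y .nil)).symm
  refine Computable.congr (t := fun e => r e ⬝ m e) ?_ fun e => .of_eq (hr' e (m e))
  refine (Computable.of_recursion (f := f) hτ (hs.apps hy)
    (apps (Γ := Γ) (τ := .N ⇾ τ ⇾ τ) (ht.cast (arrows_append Γ [.N, τ] τ)) hy) (fun e => ?_)
    fun e => ?_).app hm
  · exact (PEq.of_eq (hr' e zeroT)).trans (.eqAxiom (.rec_zero Γ τ hτ (s e) (t e) (ys e)))
  · let g : Subst n W.ctx (.N :: W.ctx) := fun x => .var x.succ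
    have hrw : ∀ y : Term n (.N :: W.ctx) .N, (r e).weaken ⬝ y =
        Term.apps (Γ := Γ ++ [.N]) ((u e).subst g) ((Args.subst g (ys e)).snoc y) := fun y =>
      (congrArg (· ⬝ y) (Term.weaken_eq_subst (r e))).trans (hr g e y)
    have hfw : ∀ (y : Term n (.N :: W.ctx) .N) (z : Term n (.N :: W.ctx) τ),
        (f e).weaken ⬝ y ⬝ z = Term.apps (Γ := Γ ++ [.N, τ]) ((t e).subst g)
          ((Args.subst g (ys e)).append (.cons y (.cons z .nil))) := fun y z =>
      (congrArg (· ⬝ y ⬝ z) (Term.weaken_eq_subst (f e))).trans (hf g e y z)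
    refine (PEq.of_eq (hrw _)).trans (PEq.trans (.eqAxiom (.rec_succ Γ τ hτ _ _ _ _))
      (PEq.symm (.of_eq ?_)))
    exact (congrArg ((f e).weaken ⬝ .var .zero ⬝ ·) (hrw _)).trans (hfw _ _)

end Computable

/-- The fundamental lemma of the logical relation. -/
theorem Term.InT.computable {σ : Ty} {t : Term n [] σ} (ht : t.InT) :
    Computable σ World.nil fun _ => t := by
  induction t with
  | var x => cases x
  | con c =>
    match c, ht with
    | .step (.ex ..), _ => exact Computable.ex
    | .step (.wk ..), _ => exact Computable.wk
    | .step (.cntr ..), _ => exact Computable.cntr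
    | .step (.cut ..), _ => exact Computable.cut
    | .step (.id _), _ => exact Computable.id
    | .step (.L ..), _ => exact Computable.L
    | .step (.R ..), _ => exact Computable.R
    | .step .zero, _ => exact derives_zero
    | .step .succ, _ =>
      exact Computable.of_derivesFun (ρs := [.N]) (by simp [Ty.lev]) derivesFun_succ
    | .recursor _ _ h, _ => exact Computable.recursor h
  | app t s iht ihs => exact (iht ht.1).app (ihs ht.2)

end CircularT

open CircularT
theorem mainTheorem1 (n : ℕ) (σ : Ty) (hσ : σ.lev ≤ n + 1)
    (t : Term n [] σ) (ht : t.InT)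
    (Γ : List Ty) (τ : Ty) (hΓτ : arrows Γ τ = σ) (hτ : τ.lev ≤ n) :
    ∃ t' : Coder n ⟨Γ, τ⟩, Provable n [] (.eq t (t'.term.cast hΓτ)) := by
  subst hΓτ
  obtain ⟨D, hD, hDC⟩ := ht.computable.derivesFun (lev_le_of_arrows hσ) hτ
  obtain ⟨C, hC⟩ := hD.exists_coder ()
  exact ⟨C, PEq.of_apps (Γ := Γ) fun Θ f xs => hDC () C hC Θ f xs⟩
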